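/- Let $v:[0,\infty)\to\mathbb{R}$ be bounded and Lipschitz with Lipschitz constant $L$. Let $\alpha,\beta\in\mathbb{R}$ and let $w:\mathbb{R}\to[0,\infty)$ vanish outside $[\alpha,\beta]$, have bounded variation on $[\alpha,\beta]$, and satisfy $\int_\alpha^\beta w(x)\,dx=1$; let $TV(w)$ be the total variation of $w$ on $\mathbb{R}$ (so the jumps at $\alpha,\beta$ count). Let $X=L^\infty\cap\mathcal{P}^{ac}_c(\mathbb{R})$ be the set of compactly supported Borel probability measures on $\mathbb{R}$ that are absolutely continuous with respect to Lebesgue measure with essentially bounded density (a measure is identified with its density), endowed with the distance $$W_\infty(\mu,\nu)=\inf_{\pi}\ \pi\text{-}\mathrm{ess\,sup}\,|x-y|,$$ where $\pi$ ranges over the Borel measures on $\mathbb{R}^2$ with marginals $\mu$ and $\nu$. Let $\rho_0\in X$. For $\mu\in X$ put $V[\mu](x)=v\left(\int w(y-x)\,d\mu(y)\right)$. A weak solution on $[0,T]$ of $$\partial_t\rho+\partial_x\big(V[\rho(t)]\,\rho\big)=0,\qquad \rho(0)=\rho_0, \tag{1}$$ is a curve $\rho\in C^0([0,T],X)$ with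 $\rho(0)=\rho_0$ such that for all $\varphi\in C_c^\infty((0,T)\times\mathbb{R})$ $$\int_0^T\int_{\mathbb{R}}\big(\partial_t\varphi(t,x)+V[\rho(t)](x)\,\partial_x\varphi(t,x)\big)\,d\rho(t)(x)\,dt=0 .$$ Then there is $T>0$ such that for every $t\in(0,T)$ problem (1) has exactly one weak solution on $[0,t]$. Moreover, for every $T>0$ with $T\,e\,L\,TV(w)\,\|\rho_0\|_{L^\infty}<1$: (a) problem (1) has exactly one weak solution $\rho$ on $[0,T]$; (b) there are Euler trajectories $\rho^n\in C^0([0,T],X)$, $n\in\mathbb{N}$, given by $\rho^n(0)=\rho_0$ and $$\rho^n(k2^{-n}T+t)=\phi^{n,k}_t\,\#\,\rho^n(k2^{-n}T),\qquad t\in[0,2^{-n}T],\ k=0,\dots,2^n-1,$$ where $\phi^{n,k}_t$ is the flow of the vector field $V[\rho^n(k2^{-n}T)]$ and $\#$ denotes push-forward, and a subsequence $(\rho^{n_j})_j$ with $\sup_{t\in[0,T]}W_\infty(\rho^{n_j}(t),\rho(t))\to0$ as $j\to\infty$. -/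

import Mathlib

open MeasureTheory Set Filter Topology
open scoped ENNReal NNReal

namespace NonlocalTransport

/-- `π` is a transference plan from `μ` to `ν`: its marginals are `μ` and `ν`. -/
def IsPlan (π : Measure (ℝ × ℝ)) (μ ν : Measure ℝ) : Prop :=
  π.map Prod.fst = μ ∧ π.map Prod.snd = ν

/-- The `∞`-Wasserstein distance: the infimum over all transference plans `π` of the
`π`-essential supremum of `|x - y|`. -/
noncomputable def Winf (μ ν : Measure ℝ) : ℝ≥0∞ :=
  ⨅ (π : Measure (ℝ × ℝ)) (_ : IsPlan π μ ν), essSup (fun p : ℝ × ℝ => edist p.1 p.2) π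

/-- The `L^∞` norm of the Lebesgue density of `μ`. -/
noncomputable def linfNorm (μ : Measure ℝ) : ℝ≥0∞ :=
  essSup (μ.rnDeriv volume) volume

/-- `L^∞ ∩ 𝒫^{ac}_c(ℝ)`: compactly supported probability measures that are absolutely
continuous with respect to the Lebesgue measure and have an essentially bounded density. -/
structure IsBddDensity (μ : Measure ℝ) : Prop where
  prob : IsProbabilityMeasure μ
  compact_supp : ∃ S : Set ℝ, IsCompact S ∧ μ Sᶜ = 0
  ac : μ ≪ volume
  bdd : linfNorm μ < ∞

/-- `C^0([0,T], L^∞ ∩ 𝒫^{ac}_c(ℝ))`, the target being endowed with the distance `Winf`.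
Only the values of the curve on `[0,T]` matter. -/
structure IsContCurve (T : ℝ) (ρ : ℝ → Measure ℝ) : Prop where
  mem : ∀ t ∈ Icc 0 T, IsBddDensity (ρ t)
  cont : ∀ s ∈ Icc 0 T, Tendsto (fun t => Winf (ρ s) (ρ t)) (𝓝[Icc 0 T] s) (𝓝 0)

/-- The velocity field `V[μ](x) = v (∫ w(y - x) dμ(y))`. -/
noncomputable def velocity (v w : ℝ → ℝ) (μ : Measure ℝ) (x : ℝ) : ℝ :=
  v (∫ y, w (y - x) ∂μ)

/-- Test functions `φ ∈ C_c^∞((0,T) × ℝ)`. -/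
structure IsTestFun (T : ℝ) (φ : ℝ × ℝ → ℝ) : Prop where
  smooth : ContDiff ℝ ((⊤ : ℕ∞) : WithTop ℕ∞) φ
  compact : HasCompactSupport φ
  supp : tsupport φ ⊆ Ioo 0 T ×ˢ univ

/-- `ρ ∈ C^0([0,T], L^∞ ∩ 𝒫^{ac}_c(ℝ))` is a weak solution on `[0,T]` of the Cauchy problem
`∂ₜρ + ∂ₓ(V[ρ(t)] ρ) = 0`, `ρ(0) = ρ₀`. -/
structure IsWeakSolution (v w : ℝ → ℝ) (ρ₀ : Measure ℝ) (T : ℝ) (ρ : ℝ → Measure ℝ) :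
    Prop where
  curve : IsContCurve T ρ
  init : ρ 0 = ρ₀
  weak : ∀ φ : ℝ × ℝ → ℝ, IsTestFun T φ →
    ∫ t in (0 : ℝ)..T, ∫ x, (deriv (fun s => φ (s, x)) t
      + velocity v w (ρ t) x * deriv (fun z => φ (t, z)) x) ∂(ρ t) = 0

/-- There is one and, as a curve on `[0,T]`, only one weak solution. -/
def ExistsUniqueWeakSolution (v w : ℝ → ℝ) (ρ₀ : Measure ℝ) (T : ℝ) : Prop :=
  (∃ ρ : ℝ → Measure ℝ, IsWeakSolution v w ρ₀ T ρ) ∧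
    ∀ ρ ρ' : ℝ → Measure ℝ, IsWeakSolution v w ρ₀ T ρ → IsWeakSolution v w ρ₀ T ρ' →
      ∀ t ∈ Icc 0 T, ρ t = ρ' t

/-- `Φ t x`, for `t ∈ [0,h]`, is the flow of the autonomous vector field `V`. -/
def IsFlow (V : ℝ → ℝ) (h : ℝ) (Φ : ℝ → ℝ → ℝ) : Prop :=
  ∀ x : ℝ, Φ 0 x = x ∧
    ∀ t ∈ Icc 0 h, HasDerivWithinAt (fun s => Φ s x) (V (Φ t x)) (Icc 0 h) t

/-- `r` is the `n`-th Euler trajectory on `[0,T]`: it starts from `ρ₀` and on each of the `2^n`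
time steps of length `2^{-n}T` it is pushed forward by the flow of the velocity field frozen at
the beginning of the step. -/
def IsEulerTrajectory (v w : ℝ → ℝ) (ρ₀ : Measure ℝ) (T : ℝ) (n : ℕ) (r : ℝ → Measure ℝ) :
    Prop :=
  r 0 = ρ₀ ∧ ∀ k : ℕ, k < 2 ^ n → ∃ Φ : ℝ → ℝ → ℝ,
    IsFlow (velocity v w (r (k * (T / 2 ^ n)))) (T / 2 ^ n) Φ ∧
      ∀ t ∈ Icc 0 (T / 2 ^ n),
        r (k * (T / 2 ^ n) + t) = (r (k * (T / 2 ^ n))).map (Φ t)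

end NonlocalTransport

/-! Convolution with a kernel of bounded variation is Lipschitz with respect to distribution
functions: if the distribution functions of `μ` and `ν` differ by at most `D`, then `V[μ]` and
`V[ν]` differ by at most `cD`, where `c = L TV(w)`. For measures with density at most `M` this makes
`V[μ]` Lipschitz in space with constant `cM`, and Lipschitz in `μ` with respect to `W_∞`.

*Existence.* The flow of a frozen velocity field consists of increasing bi-Lipschitz maps, so the
push-forward of a measure of density at most `M` over a time `h` has density at most `M exp(cMh)`.
The resulting density bounds along the Euler scheme are controlled by the Riccati equation
`dy/ds = cy²`, whose solution starting from `‖ρ₀‖_∞` does not blow up on `[0,T]` because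
`cT‖ρ₀‖_∞ < 1`. By Grönwall the Euler maps converge uniformly to the flow `X` of the field
`V[X t # ρ₀]`, and `X t # ρ₀` is a weak solution. This needs no subsequence.

*Uniqueness.* A weak solution loses no mass to the right of a front that moves at least as fast as
its velocity field. If the distribution functions of a weak solution and of `X t # ρ₀` differ by at
most `E exp(4cMt)`, then `X t x ± (E/2M) exp(4cMt)` are such fronts, and comparing the masses to
their left improves the bound to one half of itself. Hence the difference vanishes.
-/

namespace NonlocalTransport

/-! ### Measures with bounded density -/

section DensityLE

variable {M : ℝ≥0} {μ : Measure ℝ}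

/-- `μ` has a density at most `M`. Stated as an inequality of measures, so that no density has to
be chosen. -/
def DensityLE (M : ℝ≥0) (μ : Measure ℝ) : Prop := μ ≤ (M : ℝ≥0∞) • volume

lemma DensityLE.absolutelyContinuous (h : DensityLE M μ) : μ ≪ volume :=
  (Measure.absolutelyContinuous_of_le h).trans Measure.smul_absolutelyContinuous

lemma DensityLE.pos [IsProbabilityMeasure μ] (h : DensityLE M μ) : 0 < M := by
  rw [pos_iff_ne_zero]
  rintro rfl
  simpa using h univ

lemma DensityLE.linfNorm_le (h : DensityLE M μ) : linfNorm μ ≤ M := by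
  refine essSup_le_of_ae_le _ (ae_le_of_forall_setLIntegral_le_of_sigmaFinite
    (μ.measurable_rnDeriv volume) fun s _ _ => ?_)
  calc ∫⁻ x in s, μ.rnDeriv volume x ≤ μ s := Measure.setLIntegral_rnDeriv_le s
    _ ≤ _ := by simpa using h s

lemma densityLE_toNNReal_linfNorm [SigmaFinite μ] (hac : μ ≪ volume) (hμ : linfNorm μ ≠ ∞) :
    DensityLE (linfNorm μ).toNNReal μ := by
  rw [DensityLE, ENNReal.coe_toNNReal hμ]
  refine Measure.le_iff.2 fun s _ => ?_
  rw [← Measure.setLIntegral_rnDeriv hac s]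
  calc ∫⁻ x in s, μ.rnDeriv volume x ≤ ∫⁻ _ in s, linfNorm μ :=
        lintegral_mono_ae (ae_restrict_of_ae (ENNReal.ae_le_essSup _))
    _ = _ := by simp

lemma IsBddDensity.densityLE (h : IsBddDensity μ) : DensityLE (linfNorm μ).toNNReal μ :=
  have := h.prob
  densityLE_toNNReal_linfNorm h.ac h.bdd.ne

lemma isBddDensity_of_densityLE [hμ : IsProbabilityMeasure μ] (hM : DensityLE M μ) {S : Set ℝ}
    (hS : IsCompact S) (h : μ Sᶜ = 0) : IsBddDensity μ :=
  ⟨hμ, ⟨S, hS, h⟩, hM.absolutelyContinuous, hM.linfNorm_le.trans_lt ENNReal.coe_lt_top⟩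

lemma DensityLE.lipschitzWith_measureReal_Iic [IsFiniteMeasure μ] (h : DensityLE M μ) :
    LipschitzWith M fun x => μ.real (Iic x) := by
  refine LipschitzWith.of_le_add_mul _ fun x y => ?_
  rcases le_total x y with hxy | hyx
  · exact (measureReal_mono (Iic_subset_Iic.2 hxy)).trans (le_add_of_nonneg_right (by positivity))
  · rw [← Iic_union_Ioc_eq_Iic hyx]
    refine (measureReal_union_le _ _).trans ?_
    gcongr
    refine ENNReal.toReal_le_of_le_ofReal (by positivity) ((h _).trans_eq ?_)
    rw [Measure.smul_apply, Real.volume_Ioc, smul_eq_mul, Real.dist_eq,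
      abs_of_nonneg (sub_nonneg.2 hyx), ENNReal.ofReal_mul M.coe_nonneg, ENNReal.ofReal_coe_nnreal]

lemma DensityLE.map_of_antilipschitzWith (h : DensityLE M μ) {K : ℝ≥0} {f : ℝ → ℝ}
    (hf : Measurable f) (hK : AntilipschitzWith K f) : DensityLE (M * K) (μ.map f) := by
  refine Measure.le_iff.2 fun s hs => ?_
  rw [Measure.map_apply hf hs]
  calc μ (f ⁻¹' s) ≤ M * volume (f ⁻¹' s) := h _
    _ ≤ M * (K * volume s) := by
      gcongr
      simpa [hausdorffMeasure_real] using hK.hausdorffMeasure_preimage_le zero_le_one s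
    _ = _ := by simp [mul_assoc]

end DensityLE

/-! ### Uniformly close distribution functions -/

section CdfDistLE

variable {D : ℝ} {μ ν : Measure ℝ}

/-- The distribution functions of `μ` and `ν` differ by at most `D` everywhere: the Kolmogorov
distance of `μ` and `ν` is at most `D`. -/
def CdfDistLE (D : ℝ) (μ ν : Measure ℝ) : Prop := ∀ s, |μ.real (Iic s) - ν.real (Iic s)| ≤ D

lemma CdfDistLE.nonneg (h : CdfDistLE D μ ν) : 0 ≤ D := (abs_nonneg _).trans (h 0)

lemma CdfDistLE.map_add_right (h : CdfDistLE D μ ν) (z : ℝ) :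
    CdfDistLE D (μ.map (· + z)) (ν.map (· + z)) := fun s => by
  simp_rw [map_measureReal_apply (measurable_add_const z) measurableSet_Iic, preimage_add_const_Iic]
  exact h _

lemma CdfDistLE.abs_measureReal_Iio_sub_le [IsFiniteMeasure μ] [IsFiniteMeasure ν]
    (h : CdfDistLE D μ ν) (s : ℝ) : |μ.real (Iio s) - ν.real (Iio s)| ≤ D := by
  obtain ⟨u, hu_mono, hu_lt, hu⟩ := exists_seq_strictMono_tendsto s
  have hlim : ∀ κ : Measure ℝ, [IsFiniteMeasure κ] →
      Tendsto (fun n => κ.real (Iic (u n))) atTop (𝓝 (κ.real (Iio s))) := fun κ _ => by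
    rw [← iUnion_Iic_eq_Iio_of_lt_of_tendsto hu_lt hu]
    exact (ENNReal.tendsto_toReal (measure_ne_top κ _)).comp
      (tendsto_measure_iUnion_atTop fun m n hmn => Iic_subset_Iic.2 (hu_mono.monotone hmn))
  exact le_of_tendsto ((hlim μ).sub (hlim ν)).abs (Eventually.of_forall fun n => h (u n))

lemma CdfDistLE.abs_measureReal_sub_le_of_isUpperSet [IsProbabilityMeasure μ]
    [IsProbabilityMeasure ν] (h : CdfDistLE D μ ν) {A : Set ℝ} (hA : IsUpperSet A) :
    |μ.real A - ν.real A| ≤ D := by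
  rcases A.eq_empty_or_nonempty with rfl | hne
  · simpa using h.nonneg
  by_cases hb : BddBelow A
  · have hIoi : Ioi (sInf A) ⊆ A := fun x hx =>
      let ⟨y, hy, hyx⟩ := exists_lt_of_csInf_lt hne hx
      hA hyx.le hy
    have hIci : A ⊆ Ici (sInf A) := fun x hx => csInf_le hb hx
    by_cases ha : sInf A ∈ A
    · rw [hIci.antisymm fun x hx => hA hx ha, ← compl_Iio, probReal_compl_eq_one_sub
        measurableSet_Iio, probReal_compl_eq_one_sub measurableSet_Iio, sub_sub_sub_cancel_left,
        abs_sub_comm]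
      exact h.abs_measureReal_Iio_sub_le _
    · have hA_eq : A = Ioi (sInf A) :=
        hIoi.antisymm' fun x hx => lt_of_le_of_ne (hIci hx) (ne_of_mem_of_not_mem hx ha).symm
      rw [hA_eq, ← compl_Iic, probReal_compl_eq_one_sub measurableSet_Iic,
        probReal_compl_eq_one_sub measurableSet_Iic, sub_sub_sub_cancel_left, abs_sub_comm]
      exact h _
  · have : A = univ := eq_univ_of_forall fun x =>
      let ⟨y, hy, hyx⟩ := not_bddBelow_iff.1 hb x
      hA hyx.le hy
    simpa [this] using h.nonneg

lemma cdfDistLE_map {Ω : Type*} [MeasurableSpace Ω] {P : Measure Ω} [IsProbabilityMeasure P]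
    {f g : Ω → ℝ} (hf : Measurable f) (hg : Measurable g) {M : ℝ≥0} {d : ℝ}
    (hfM : DensityLE M (P.map f)) (hfg : ∀ᵐ x ∂P, |f x - g x| ≤ d) :
    CdfDistLE (M * d) (P.map f) (P.map g) := fun s => by
  have := Measure.isProbabilityMeasure_map (μ := P) hf.aemeasurable
  have hd : 0 ≤ d := let ⟨x, hx⟩ := hfg.exists; (abs_nonneg _).trans hx
  have shift : ∀ r, |(P.map f).real (Iic s) - (P.map f).real (Iic r)| ≤ M * |s - r| := fun r =>
    hfM.lipschitzWith_measureReal_Iic.dist_le_mul s r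
  have upper : (P.map g).real (Iic s) ≤ (P.map f).real (Iic (s + d)) := by
    rw [map_measureReal_apply hg measurableSet_Iic, map_measureReal_apply hf measurableSet_Iic]
    refine ENNReal.toReal_mono (measure_ne_top _ _) (measure_mono_ae ?_)
    filter_upwards [hfg] with x hx (hxs : g x ≤ s)
    exact (show f x ≤ s + d by linarith [le_abs_self (f x - g x)])
  have lower : (P.map f).real (Iic (s - d)) ≤ (P.map g).real (Iic s) := by
    rw [map_measureReal_apply hg measurableSet_Iic, map_measureReal_apply hf measurableSet_Iic]
    refine ENNReal.toReal_mono (measure_ne_top _ _) (measure_mono_ae ?_)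
    filter_upwards [hfg] with x hx (hxs : f x ≤ s - d)
    exact (show g x ≤ s by linarith [neg_abs_le (f x - g x)])
  have shift_upper := shift (s + d)
  have shift_lower := shift (s - d)
  rw [sub_add_cancel_left, abs_neg, abs_of_nonneg hd] at shift_upper
  rw [sub_sub_cancel, abs_of_nonneg hd] at shift_lower
  rw [abs_le] at *
  constructor <;> linarith

end CdfDistLE

/-! ### Integrals of functions of bounded variation -/

lemma integrable_of_monotone_of_sub_le {μ : Measure ℝ} [IsFiniteMeasure μ] {p : ℝ → ℝ}
    (hp : Monotone p) {R : ℝ} (hR : ∀ x y, p y - p x ≤ R) : Integrable p μ :=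
  Integrable.of_bound hp.measurable.aestronglyMeasurable (|p 0| + R) <| ae_of_all _ fun x => by
    rw [Real.norm_eq_abs, abs_le]
    constructor <;> linarith [hR 0 x, hR x 0, neg_abs_le (p 0), le_abs_self (p 0)]

lemma exists_monotone_eq_sub {w : ℝ → ℝ} (hw : BoundedVariationOn w univ) :
    ∃ (p q : ℝ → ℝ) (R S : ℝ), Monotone p ∧ Monotone q ∧ (∀ x y, p y - p x ≤ R) ∧
      (∀ x y, q y - q x ≤ S) ∧ R + S ≤ (eVariationOn w univ).toReal ∧ w = p - q := by
  set V := variationOnFromTo w univ 0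
  have hadd : Monotone (V + w) := monotoneOn_univ.1
    (variationOnFromTo.add_self_monotoneOn hw.locallyBoundedVariationOn (mem_univ 0))
  have hsub : Monotone (V - w) := monotoneOn_univ.1
    (variationOnFromTo.sub_self_monotoneOn hw.locallyBoundedVariationOn (mem_univ 0))
  have hV : ∀ x y, V y - V x ≤ (eVariationOn w univ).toReal := fun x y => by
    rw [variationOnFromTo.sub_right hw.locallyBoundedVariationOn (mem_univ _) (mem_univ _)
      (mem_univ _)]
    exact (le_abs_self _).trans (variationOnFromTo.abs_le_eVariationOn hw)
  set p : ℝ → ℝ := fun x => (V x + w x) / 2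
  set q : ℝ → ℝ := fun x => (V x - w x) / 2
  have hp : Monotone p := fun x y hxy => div_le_div_of_nonneg_right (hadd hxy) zero_le_two
  have hq : Monotone q := fun x y hxy => div_le_div_of_nonneg_right (hsub hxy) zero_le_two
  have osc_add_osc : ∀ x y x' y', p y - p x + (q y' - q x') ≤ (eVariationOn w univ).toReal :=
    fun x y x' y' => by
      have hVlohi := hV (min x x') (max y y')
      linarith [hp (min_le_left x x'), hp (le_max_left y y'), hq (min_le_right x x'),
        hq (le_max_right y y'), add_halves (V (min x x')), add_halves (V (max y y')),
        show p (min x x') + q (min x x') = V (min x x') by ring,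
        show p (max y y') + q (max y y') = V (max y y') by ring]
  have hbdd : BddAbove (range fun z : ℝ × ℝ => p z.2 - p z.1) :=
    ⟨_, by rintro _ ⟨z, rfl⟩; simpa using osc_add_osc z.1 z.2 0 0⟩
  set R := ⨆ z : ℝ × ℝ, p z.2 - p z.1
  refine ⟨p, q, R, (eVariationOn w univ).toReal - R, hp, hq, fun x y => le_ciSup hbdd (x, y),
    fun x y => ?_, by simp, funext fun x => by simp only [Pi.sub_apply, p, q]; ring⟩
  exact le_sub_comm.1 (ciSup_le fun z => le_sub_right_of_add_le (osc_add_osc z.1 z.2 x y))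

section CdfDistLE

variable {D : ℝ} {μ ν : Measure ℝ} [IsProbabilityMeasure μ] [IsProbabilityMeasure ν]

lemma CdfDistLE.abs_integral_sub_le_of_monotone_of_mem_Icc (h : CdfDistLE D μ ν) {p : ℝ → ℝ}
    (hp : Monotone p) {R : ℝ} (hR : ∀ x, p x ∈ Icc 0 R) :
    |∫ y, p y ∂μ - ∫ y, p y ∂ν| ≤ R * D := by
  have layer_cake : ∀ κ : Measure ℝ, [IsProbabilityMeasure κ] →
      ∫ y, p y ∂κ = ∫ t in Ioc 0 R, κ.real {y | t ≤ p y} := fun κ _ =>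
    (integrable_of_monotone_of_sub_le hp
      fun x y => (sub_le_self _ (hR x).1).trans (hR y).2).integral_eq_integral_Ioc_meas_le
      (ae_of_all _ fun x => (hR x).1) (ae_of_all _ fun x => (hR x).2)
  have integrable : ∀ κ : Measure ℝ, [IsProbabilityMeasure κ] →
      IntegrableOn (fun t => κ.real {y | t ≤ p y}) (Ioc 0 R) := fun κ _ => by
    have hanti : Antitone (fun t => κ.real {y | t ≤ p y}) := fun s t hst =>
      measureReal_mono fun y hy => hst.trans hy
    exact Integrable.of_bound hanti.measurable.aestronglyMeasurable 1
      (ae_of_all _ fun t => by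
        rw [Real.norm_eq_abs, abs_of_nonneg measureReal_nonneg]; exact measureReal_le_one)
  rw [layer_cake μ, layer_cake ν, ← integral_sub (integrable μ) (integrable ν)]
  have := norm_setIntegral_le_of_norm_le_const (μ := volume) (s := Ioc 0 R) (C := D)
    (f := fun t => μ.real {y | t ≤ p y} - ν.real {y | t ≤ p y}) (by simp)
    fun t _ => h.abs_measureReal_sub_le_of_isUpperSet fun x y hxy hx => le_trans hx (hp hxy)
  simpa [(hR 0).1.trans (hR 0).2, mul_comm] using this

lemma CdfDistLE.abs_integral_sub_le_of_monotone (h : CdfDistLE D μ ν) {p : ℝ → ℝ}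
    (hp : Monotone p) {R : ℝ} (hR : ∀ x y, p y - p x ≤ R) :
    |∫ y, p y ∂μ - ∫ y, p y ∂ν| ≤ R * D := by
  have hbdd : BddBelow (range p) := ⟨p 0 - R, by rintro _ ⟨x, rfl⟩; linarith [hR x 0]⟩
  have hmem : ∀ x, p x - ⨅ z, p z ∈ Icc 0 R := fun x =>
    ⟨sub_nonneg.2 (ciInf_le hbdd x),
      sub_le_comm.1 (le_ciInf fun y => sub_le_comm.1 (hR y x))⟩
  have hp_sub : Monotone fun x => p x - ⨅ z, p z := fun x y hxy => sub_le_sub_right (hp hxy) _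
  have := h.abs_integral_sub_le_of_monotone_of_mem_Icc hp_sub hmem
  rw [integral_sub (integrable_of_monotone_of_sub_le hp hR) (integrable_const _),
    integral_sub (integrable_of_monotone_of_sub_le hp hR) (integrable_const _)] at this
  simpa using this

lemma CdfDistLE.abs_integral_sub_le_of_boundedVariationOn (h : CdfDistLE D μ ν) {w : ℝ → ℝ}
    (hw : BoundedVariationOn w univ) :
    |∫ y, w y ∂μ - ∫ y, w y ∂ν| ≤ (eVariationOn w univ).toReal * D := by
  obtain ⟨p, q, R, S, hp, hq, hpR, hqS, hRS, rfl⟩ := exists_monotone_eq_sub hw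
  simp only [Pi.sub_apply]
  rw [integral_sub (integrable_of_monotone_of_sub_le hp hpR)
      (integrable_of_monotone_of_sub_le hq hqS),
    integral_sub (integrable_of_monotone_of_sub_le hp hpR)
      (integrable_of_monotone_of_sub_le hq hqS), sub_sub_sub_comm]
  calc _ ≤ |∫ y, p y ∂μ - ∫ y, p y ∂ν| + |∫ y, q y ∂μ - ∫ y, q y ∂ν| := abs_sub _ _
    _ ≤ R * D + S * D := add_le_add (h.abs_integral_sub_le_of_monotone hp hpR)
        (h.abs_integral_sub_le_of_monotone hq hqS)
    _ = (R + S) * D := (add_mul _ _ _).symm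
    _ ≤ _ := mul_le_mul_of_nonneg_right hRS h.nonneg

end CdfDistLE

lemma boundedVariationOn_univ_of_support_subset_Icc {w : ℝ → ℝ} {α β : ℝ}
    (hw : BoundedVariationOn w (Icc α β)) (hsupp : Function.support w ⊆ Icc α β) :
    BoundedVariationOn w univ := by
  have hzero : ∀ x ∉ Icc α β, w x = 0 := fun x hx => by_contra fun h => hx (hsupp h)
  rcases lt_or_ge β α with hβα | hαβ
  · have : w = fun _ => 0 := funext fun x => hzero x (by simp [Icc_eq_empty_of_lt hβα])
    simp [this, BoundedVariationOn, eVariationOn.constant_on]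
  have of_step : ∀ {s A : Set ℝ}, IsUpperSet A → ∀ a b : ℝ,
      EqOn w (fun x => a + b * A.indicator 1 x) s → BoundedVariationOn w s :=
    fun {s A} hA a b heq => by
      have hmono : Monotone (A.indicator (1 : ℝ → ℝ)) := fun x y hxy => by
        by_cases hx : x ∈ A
        · simp [hx, hA hxy hx]
        · rw [indicator_of_notMem hx]
          exact indicator_apply_nonneg fun _ => zero_le_one' ℝ
      have hφ : LipschitzWith ‖b‖₊ fun y : ℝ => a + b * y := by
        simpa using (LipschitzWith.const a).add (lipschitzWith_smul b)
      rw [BoundedVariationOn, eVariationOn.congr heq]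
      refine hφ.comp_boundedVariationOn ((hmono.monotoneOn s).boundedVariationOn (C := 1) ?_)
      intro x _
      by_cases hx : x ∈ A <;> simp [hx]
  have hIic : BoundedVariationOn w (Iic α) :=
    of_step (isUpperSet_Ici α) 0 (w α) fun x (hx : x ≤ α) => by
      rcases hx.eq_or_lt with rfl | hx
      · simp
      · simp [hx, hzero x fun h => hx.not_ge h.1]
  have hIci : BoundedVariationOn w (Ici β) :=
    of_step (isUpperSet_Ioi β) (w β) (-w β) fun x (hx : β ≤ x) => by
      rcases hx.eq_or_lt with rfl | hx
      · simp
      · simp [hx, hzero x fun h => hx.not_ge h.2]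
  rw [BoundedVariationOn, ← Iic_union_Ici (a := α), eVariationOn.union w isGreatest_Iic isLeast_Ici,
    ← Icc_union_Ici_eq_Ici hαβ, eVariationOn.union w (isGreatest_Icc hαβ) isLeast_Ici]
  exact ENNReal.add_ne_top.2 ⟨hIic, ENNReal.add_ne_top.2 ⟨hw, hIci⟩⟩

/-! ### Nonlocal velocity fields -/

/-- Velocity fields `V μ` depending on a measure `μ` which are bounded by `C`, commute with
translations, and are Lipschitz in the distribution function of `μ`, with constant `c`. These are
the only properties of `velocity v w` that the construction and the uniqueness of solutions use. -/
structure IsNonlocalField (V : Measure ℝ → ℝ → ℝ) (c C : ℝ≥0) : Prop where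
  bound : ∀ (μ : Measure ℝ) [IsProbabilityMeasure μ] (x : ℝ), |V μ x| ≤ C
  translation : ∀ (μ : Measure ℝ) (x z : ℝ), V (μ.map (· + z)) (x + z) = V μ x
  lip : ∀ {μ ν : Measure ℝ} [IsProbabilityMeasure μ] [IsProbabilityMeasure ν] {D : ℝ},
    CdfDistLE D μ ν → ∀ x : ℝ, |V μ x - V ν x| ≤ c * D

lemma velocity_map_add_right (v w : ℝ → ℝ) (μ : Measure ℝ) (x z : ℝ) :
    velocity v w (μ.map (· + z)) (x + z) = velocity v w μ x := by
  simp only [velocity, (measurableEmbedding_addRight z).integral_map, add_sub_add_right_eq_sub]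

lemma isNonlocalField_velocity {v w : ℝ → ℝ} {L C : ℝ≥0} (hv : LipschitzOnWith L v (Ici 0))
    (hvb : ∀ s ∈ Ici (0 : ℝ), |v s| ≤ C) (hw : BoundedVariationOn w univ) (hw0 : ∀ x, 0 ≤ w x) :
    IsNonlocalField (velocity v w) (L * (eVariationOn w univ).toNNReal) C where
  bound μ _ x := hvb _ (mem_Ici.2 (integral_nonneg fun y => hw0 (y - x)))
  translation := velocity_map_add_right v w
  lip {μ ν} _ _ {D} h x := by
    have at_zero : ∀ κ : Measure ℝ, velocity v w κ x = v (∫ y, w y ∂(κ.map (· + -x))) := fun κ => by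
      simpa [velocity] using (velocity_map_add_right v w κ x (-x)).symm
    have : IsProbabilityMeasure (μ.map (· + -x)) :=
      Measure.isProbabilityMeasure_map (measurable_add_const _).aemeasurable
    have : IsProbabilityMeasure (ν.map (· + -x)) :=
      Measure.isProbabilityMeasure_map (measurable_add_const _).aemeasurable
    rw [at_zero, at_zero, NNReal.coe_mul, mul_assoc]
    calc _ ≤ L * |∫ y, w y ∂(μ.map (· + -x)) - ∫ y, w y ∂(ν.map (· + -x))| :=
          hv.dist_le_mul _ (mem_Ici.2 (integral_nonneg hw0)) _ (mem_Ici.2 (integral_nonneg hw0))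
      _ ≤ L * ((eVariationOn w univ).toReal * D) := by
          gcongr
          exact (h.map_add_right (-x)).abs_integral_sub_le_of_boundedVariationOn hw

section

variable {V : Measure ℝ → ℝ → ℝ} {c C M : ℝ≥0} {μ : Measure ℝ} [IsProbabilityMeasure μ]

lemma IsNonlocalField.lipschitzWith (hV : IsNonlocalField V c C) (hM : DensityLE M μ) :
    LipschitzWith (c * M) (V μ) := by
  refine LipschitzWith.of_dist_le_mul fun x y => ?_
  have : IsProbabilityMeasure (μ.map (· + (y - x))) :=
    Measure.isProbabilityMeasure_map (measurable_add_const _).aemeasurable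
  have hclose : CdfDistLE (M * |x - y|) (μ.map id) (μ.map (· + (y - x))) :=
    cdfDistLE_map measurable_id (measurable_add_const _) (by rwa [Measure.map_id])
      (ae_of_all _ fun z => by simp)
  rw [Measure.map_id] at hclose
  calc dist (V μ x) (V μ y) = |V μ y - V (μ.map (· + (y - x))) y| := by
        rw [dist_comm, Real.dist_eq, ← hV.translation μ x (y - x), add_sub_cancel]
    _ ≤ c * (M * |x - y|) := hV.lip hclose y
    _ = _ := by rw [NNReal.coe_mul, mul_assoc, Real.dist_eq]

lemma IsNonlocalField.abs_sub_le_of_cdfDistLE (hV : IsNonlocalField V c C) (hM : DensityLE M μ)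
    {ν : Measure ℝ} [IsProbabilityMeasure ν] {D : ℝ} (h : CdfDistLE D μ ν) (x y : ℝ) :
    |V μ x - V ν y| ≤ c * (M * |x - y| + D) :=
  calc |V μ x - V ν y| ≤ |V μ x - V μ y| + |V μ y - V ν y| := abs_sub_le _ _ _
    _ ≤ (c * M : ℝ≥0) * |x - y| + c * D :=
        add_le_add ((hV.lipschitzWith hM).dist_le_mul x y) (hV.lip h y)
    _ = _ := by push_cast; ring

end

/-! ### Increasing bi-Lipschitz maps -/

/-- `f` is increasing, and both `f` and its inverse are `κ`-Lipschitz. Transport along such maps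
keeps densities bounded. -/
structure IsMonoBiLipschitz (κ : ℝ≥0) (f : ℝ → ℝ) : Prop where
  monotone : Monotone f
  lipschitz : LipschitzWith κ f
  antilipschitz : AntilipschitzWith κ f

namespace IsMonoBiLipschitz

variable {κ κ' : ℝ≥0} {f g : ℝ → ℝ}

lemma strictMono (h : IsMonoBiLipschitz κ f) : StrictMono f :=
  h.monotone.strictMono_of_injective h.antilipschitz.injective

lemma measurable (h : IsMonoBiLipschitz κ f) : Measurable f := h.monotone.measurable

lemma densityLE_map (h : IsMonoBiLipschitz κ f) {M : ℝ≥0} {μ : Measure ℝ} (hM : DensityLE M μ) :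
    DensityLE (M * κ) (μ.map f) :=
  hM.map_of_antilipschitzWith h.measurable h.antilipschitz

lemma isProbabilityMeasure_map (h : IsMonoBiLipschitz κ f) (μ : Measure ℝ)
    [IsProbabilityMeasure μ] : IsProbabilityMeasure (μ.map f) :=
  Measure.isProbabilityMeasure_map h.measurable.aemeasurable

lemma measureReal_map_Iic (h : IsMonoBiLipschitz κ f) (μ : Measure ℝ) (x : ℝ) :
    (μ.map f).real (Iic (f x)) = μ.real (Iic x) := by
  rw [map_measureReal_apply h.measurable measurableSet_Iic]
  congr 1
  ext y
  exact h.strictMono.le_iff_le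

lemma mono (h : IsMonoBiLipschitz κ f) (hκ : κ ≤ κ') : IsMonoBiLipschitz κ' f where
  monotone := h.monotone
  lipschitz := h.lipschitz.weaken hκ
  antilipschitz x y := (h.antilipschitz x y).trans (by gcongr)

lemma comp (hg : IsMonoBiLipschitz κ' g) (hf : IsMonoBiLipschitz κ f) :
    IsMonoBiLipschitz (κ * κ') (g ∘ f) where
  monotone := hg.monotone.comp hf.monotone
  lipschitz := mul_comm κ κ' ▸ hg.lipschitz.comp hf.lipschitz
  antilipschitz := hg.antilipschitz.comp hf.antilipschitz

lemma id : IsMonoBiLipschitz 1 id := ⟨monotone_id, LipschitzWith.id, AntilipschitzWith.id⟩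

lemma of_tendsto {ι : Type*} {l : Filter ι} [l.NeBot] {F : ι → ℝ → ℝ}
    (h : ∀ i, IsMonoBiLipschitz κ (F i)) (hF : ∀ x, Tendsto (F · x) l (𝓝 (f x))) :
    IsMonoBiLipschitz κ f where
  monotone _ _ hxy := le_of_tendsto_of_tendsto' (hF _) (hF _) fun i => (h i).monotone hxy
  lipschitz := LipschitzWith.of_dist_le_mul fun x y =>
    le_of_tendsto' ((hF x).dist (hF y)) fun i => (h i).lipschitz.dist_le_mul x y
  antilipschitz := AntilipschitzWith.of_le_mul_dist fun x y =>
    ge_of_tendsto' (((hF x).dist (hF y)).const_mul _) fun i => (h i).antilipschitz.le_mul_dist x y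

end IsMonoBiLipschitz

/-! ### Flows of bounded Lipschitz fields -/

lemma hasDerivWithinAt_Ici_of_Icc {f : ℝ → ℝ} {f' a b t : ℝ} (ht : t ∈ Ico a b)
    (h : HasDerivWithinAt f f' (Icc a b) t) : HasDerivWithinAt f f' (Ici t) t :=
  h.mono_of_mem_nhdsWithin (Icc_mem_nhdsGE_of_mem ht)

section

variable {U : ℝ → ℝ} {K C : ℝ≥0} {h : ℝ}

lemma exists_isFlow (hU : LipschitzWith K U) (hC : ∀ x, |U x| ≤ C) (hh : 0 ≤ h) :
    ∃ Φ, IsFlow U h Φ := by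
  have trajectory : ∀ x : ℝ, ∃ φ : ℝ → ℝ, φ 0 = x ∧
      ∀ t ∈ Icc 0 h, HasDerivWithinAt φ (U (φ t)) (Icc 0 h) t := fun x => by
    have hPL : IsPicardLindelof (fun _ y => U y) (⟨0, left_mem_Icc.2 hh⟩ : Icc (0 : ℝ) h) x
        (C * h.toNNReal) 0 C K :=
      { lipschitzOnWith := fun _ _ => hU.lipschitzOnWith
        continuousOn := fun _ _ => continuousOn_const
        norm_le := fun _ _ y _ => hC y
        mul_max_le := by simp [hh] }
    exact hPL.exists_eq_forall_mem_Icc_hasDerivWithinAt₀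
  choose Φ hΦ using trajectory
  exact ⟨fun t x => Φ x t, hΦ⟩

variable {Φ : ℝ → ℝ → ℝ}

lemma IsFlow.lipschitzOnWith (hC : ∀ x, |U x| ≤ C) (hΦ : IsFlow U h Φ) (x : ℝ) :
    LipschitzOnWith C (fun t => Φ t x) (Icc 0 h) :=
  (convex_Icc 0 h).lipschitzOnWith_of_nnnorm_hasDerivWithin_le (hΦ x).2 fun _ _ => hC _

lemma IsFlow.lipschitzWith (hU : LipschitzWith K U) (hΦ : IsFlow U h Φ) {t : ℝ}
    (ht : t ∈ Icc 0 h) : LipschitzWith (Real.exp (K * t)).toNNReal (Φ t) := by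
  have hcont : ∀ x, ContinuousOn (fun s => Φ s x) (Icc 0 h) := fun x s hs =>
    ((hΦ x).2 s hs).continuousWithinAt
  have hderiv : ∀ x, ∀ s ∈ Ico 0 h, HasDerivWithinAt (fun s => Φ s x) (U (Φ s x)) (Ici s) s :=
    fun x s hs => hasDerivWithinAt_Ici_of_Icc hs ((hΦ x).2 s (Ico_subset_Icc_self hs))
  refine LipschitzWith.of_dist_le_mul fun x y => ?_
  have := dist_le_of_trajectories_ODE (v := fun _ => U) (fun _ => hU) (hcont x) (hderiv x)
    (hcont y) (hderiv y) le_rfl t ht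
  rwa [(hΦ x).1, (hΦ y).1, sub_zero, mul_comm, ← Real.coe_toNNReal _ (Real.exp_pos _).le] at this

lemma IsFlow.antilipschitzWith (hU : LipschitzWith K U) (hΦ : IsFlow U h Φ) {t : ℝ}
    (ht : t ∈ Icc 0 h) : AntilipschitzWith (Real.exp (K * t)).toNNReal (Φ t) := by
  have hderiv : ∀ x, ∀ s ∈ Icc 0 t, HasDerivWithinAt (fun s => Φ (t - s) x)
      (-U (Φ (t - s) x)) (Icc 0 t) s := fun x s hs => by
    have hts : t - s ∈ Icc 0 t := ⟨sub_nonneg.2 hs.2, sub_le_self _ hs.1⟩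
    have := (((hΦ x).2 (t - s) ⟨hts.1, hts.2.trans ht.2⟩).mono (Icc_subset_Icc_right ht.2)).scomp s
      ((hasDerivWithinAt_id s (Icc 0 t)).const_sub t)
      fun r hr => ⟨sub_nonneg.2 hr.2, sub_le_self _ hr.1⟩
    exact this.congr_deriv (by simp)
  have hcont : ∀ x, ContinuousOn (fun s => Φ (t - s) x) (Icc 0 t) := fun x s hs =>
    (hderiv x s hs).continuousWithinAt
  have hderiv' : ∀ x, ∀ s ∈ Ico 0 t, HasDerivWithinAt (fun s => Φ (t - s) x)
      (-U (Φ (t - s) x)) (Ici s) s := fun x s hs =>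
    hasDerivWithinAt_Ici_of_Icc hs (hderiv x s (Ico_subset_Icc_self hs))
  refine AntilipschitzWith.of_le_mul_dist fun x y => ?_
  have := dist_le_of_trajectories_ODE (v := fun _ y => -U y) (fun _ => hU.neg) (hcont x)
    (hderiv' x) (hcont y) (hderiv' y) le_rfl t (right_mem_Icc.2 ht.1)
  rwa [sub_self, sub_zero, (hΦ x).1, (hΦ y).1, mul_comm,
    ← Real.coe_toNNReal _ (Real.exp_pos _).le] at this

lemma IsFlow.isMonoBiLipschitz (hU : LipschitzWith K U) (hΦ : IsFlow U h Φ) {t : ℝ}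
    (ht : t ∈ Icc 0 h) : IsMonoBiLipschitz (Real.exp (K * t)).toNNReal (Φ t) where
  monotone x y hxy := by
    by_contra! hcross
    have hcont : ContinuousOn (fun s => Φ s y - Φ s x) (Icc 0 t) := fun s hs =>
      (((hΦ y).2 s ⟨hs.1, hs.2.trans ht.2⟩).sub
        ((hΦ x).2 s ⟨hs.1, hs.2.trans ht.2⟩)).continuousWithinAt.mono (Icc_subset_Icc_right ht.2)
    obtain ⟨s, hs, hmeet⟩ := intermediate_value_Icc' ht.1 hcont
      (show (0 : ℝ) ∈ Icc _ _ from ⟨by linarith, by rw [(hΦ x).1, (hΦ y).1]; linarith⟩)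
    have hyx : y = x := (hΦ.antilipschitzWith hU ⟨hs.1, hs.2.trans ht.2⟩).injective
      (sub_eq_zero.1 hmeet)
    exact hcross.ne (by rw [hyx])
  lipschitz := hΦ.lipschitzWith hU ht
  antilipschitz := hΦ.antilipschitzWith hU ht

end

/-! ### The Euler scheme in Lagrangian coordinates -/

open Classical in
/-- A flow of `U` on `[0,h]`; the junk value, if there is none, is the identity at all times, so
that `someFlow U h 0` is the identity in any case. -/
noncomputable def someFlow (U : ℝ → ℝ) (h : ℝ) : ℝ → ℝ → ℝ :=
  if H : ∃ Φ, IsFlow U h Φ then H.choose else fun _ x => x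

lemma isFlow_someFlow {U : ℝ → ℝ} {h : ℝ} (H : ∃ Φ, IsFlow U h Φ) :
    IsFlow U h (someFlow U h) := by
  rw [someFlow, dif_pos H]
  exact H.choose_spec

lemma someFlow_zero (U : ℝ → ℝ) (h x : ℝ) : someFlow U h 0 x = x := by
  by_cases H : ∃ Φ, IsFlow U h Φ
  · exact (isFlow_someFlow H x).1
  · rw [someFlow, dif_neg H]

/-- `eulerStep V ρ₀ h k x` is the position, after `k` steps of length `h` of the Euler scheme
started from `ρ₀`, of the particle that starts at `x`. -/
noncomputable def eulerStep (V : Measure ℝ → ℝ → ℝ) (ρ₀ : Measure ℝ) (h : ℝ) : ℕ → ℝ → ℝ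
  | 0 => id
  | k + 1 => someFlow (V (ρ₀.map (eulerStep V ρ₀ h k))) h h ∘ eulerStep V ρ₀ h k

/-- `eulerMap V ρ₀ h t x` is the position at time `t ≥ 0` of the particle that starts at `x`, in
the Euler scheme with steps of length `h` started from `ρ₀`. -/
noncomputable def eulerMap (V : Measure ℝ → ℝ → ℝ) (ρ₀ : Measure ℝ) (h t : ℝ) : ℝ → ℝ :=
  someFlow (V (ρ₀.map (eulerStep V ρ₀ h ⌊t / h⌋₊))) h (t - ⌊t / h⌋₊ * h) ∘
    eulerStep V ρ₀ h ⌊t / h⌋₊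

lemma eulerMap_add (V : Measure ℝ → ℝ → ℝ) (ρ₀ : Measure ℝ) {h t : ℝ} (hh : 0 < h) (k : ℕ)
    (ht : t ∈ Icc 0 h) :
    eulerMap V ρ₀ h (k * h + t) =
      someFlow (V (ρ₀.map (eulerStep V ρ₀ h k))) h t ∘ eulerStep V ρ₀ h k := by
  rcases ht.2.eq_or_lt with rfl | hlt
  · have hfloor : ⌊(k * t + t) / t⌋₊ = k + 1 := by
      rw [← add_one_mul, mul_div_cancel_right₀ _ hh.ne']
      exact_mod_cast Nat.floor_natCast (R := ℝ) (k + 1)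
    funext x
    simp only [eulerMap, hfloor, Function.comp_apply, Nat.cast_add, Nat.cast_one, add_one_mul,
      sub_self, someFlow_zero]
    rfl
  · have hfloor : ⌊(k * h + t) / h⌋₊ = k := by
      have := ht.1
      rw [Nat.floor_eq_iff (by positivity), le_div_iff₀ hh, div_lt_iff₀ hh]
      constructor <;> linarith
    simp only [eulerMap, hfloor, add_sub_cancel_left]

lemma eulerMap_natCast_mul (V : Measure ℝ → ℝ → ℝ) (ρ₀ : Measure ℝ) {h : ℝ} (hh : 0 < h)
    (k : ℕ) : eulerMap V ρ₀ h (k * h) = eulerStep V ρ₀ h k := by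
  have := eulerMap_add V ρ₀ hh k (left_mem_Icc.2 hh.le)
  rw [add_zero] at this
  rw [this]
  funext x
  exact someFlow_zero _ _ _

lemma eulerMap_zero (V : Measure ℝ → ℝ → ℝ) (ρ₀ : Measure ℝ) {h : ℝ} (hh : 0 < h) :
    eulerMap V ρ₀ h 0 = id := by
  simpa [eulerStep] using eulerMap_natCast_mul V ρ₀ hh 0

lemma exists_eq_natCast_mul_add {h t : ℝ} (hh : 0 < h) (ht : 0 ≤ t) :
    ∃ (k : ℕ) (s : ℝ), s ∈ Ico 0 h ∧ t = k * h + s := by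
  have floor_le := Nat.floor_le (div_nonneg ht hh.le)
  have lt_floor := Nat.lt_floor_add_one (t / h)
  rw [le_div_iff₀ hh] at floor_le
  rw [div_lt_iff₀ hh] at lt_floor
  exact ⟨⌊t / h⌋₊, t - ⌊t / h⌋₊ * h, ⟨by linarith, by linarith⟩, by ring⟩

-- `y s = (1 - b * s)⁻¹` is increasing and solves `dy/ds = b * y * y`, so over a time `t` it grows
-- at least as much as with the rate `b * y s` frozen.
lemma inv_mul_exp_le {b s t : ℝ} (hb : 0 ≤ b) (ht : 0 ≤ t) (hst : b * (s + t) < 1) :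
    (1 - b * s)⁻¹ * Real.exp (b * (1 - b * s)⁻¹ * t) ≤ (1 - b * (s + t))⁻¹ := by
  have hs : 0 < 1 - b * s := by nlinarith [mul_nonneg hb ht]
  set u := b * (1 - b * s)⁻¹ * t with hu
  have hfactor : (1 - b * s) * (1 - u) = 1 - b * (s + t) := by rw [hu]; field_simp; ring
  have hu1 : 0 < 1 - u := pos_of_mul_pos_right (by rw [hfactor]; linarith) hs.le
  rw [← hfactor, mul_inv]
  gcongr
  rw [← inv_inv (Real.exp u), ← Real.exp_neg]
  exact inv_anti₀ hu1 (Real.one_sub_le_exp_neg u)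

lemma lipschitzOnWith_Icc_of_Icc_of_Icc {E : Type*} [PseudoMetricSpace E] {f : ℝ → E} {C : ℝ≥0}
    {a b c : ℝ} (hab : LipschitzOnWith C f (Icc a b)) (hbc : LipschitzOnWith C f (Icc b c)) :
    LipschitzOnWith C f (Icc a c) := by
  refine LipschitzOnWith.of_dist_le_mul fun x hx y hy => ?_
  wlog hxy : x ≤ y generalizing x y
  · rw [dist_comm, dist_comm x]; exact this y hy x hx (le_of_not_ge hxy)
  rcases le_total y b with hyb | hby
  · exact hab.dist_le_mul x ⟨hx.1, hxy.trans hyb⟩ y ⟨hy.1, hyb⟩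
  rcases le_total b x with hbx | hxb
  · exact hbc.dist_le_mul x ⟨hbx, hx.2⟩ y ⟨hby, hy.2⟩
  calc dist (f x) (f y) ≤ dist (f x) (f b) + dist (f b) (f y) := dist_triangle _ _ _
    _ ≤ C * dist x b + C * dist b y :=
        add_le_add (hab.dist_le_mul x ⟨hx.1, hxb⟩ b ⟨hx.1.trans hxb, le_rfl⟩)
          (hbc.dist_le_mul b ⟨le_rfl, hby.trans hy.2⟩ y ⟨hby, hy.2⟩)
    _ = C * dist x y := by
        rw [← mul_add, Real.dist_eq, Real.dist_eq, Real.dist_eq, abs_of_nonpos (sub_nonpos.2 hxb),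
          abs_of_nonpos (sub_nonpos.2 hby), abs_of_nonpos (sub_nonpos.2 hxy)]
        ring

section

variable {V : Measure ℝ → ℝ → ℝ} {c C : ℝ≥0} (hV : IsNonlocalField V c C) {ρ₀ : Measure ℝ}
  [IsProbabilityMeasure ρ₀] {a : ℝ≥0} (ha : DensityLE a ρ₀)

include hV ha in
lemma isFlow_someFlow_map {κ : ℝ≥0} {h : ℝ} {f : ℝ → ℝ} (hf : IsMonoBiLipschitz κ f)
    (hh : 0 ≤ h) : IsFlow (V (ρ₀.map f)) h (someFlow (V (ρ₀.map f)) h) :=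
  have := hf.isProbabilityMeasure_map ρ₀
  isFlow_someFlow (exists_isFlow (hV.lipschitzWith (hf.densityLE_map ha)) (hV.bound _) hh)

include hV ha in
lemma isMonoBiLipschitz_someFlow_comp {h s t : ℝ} {f : ℝ → ℝ}
    (hf : IsMonoBiLipschitz (1 - c * a * s)⁻¹.toNNReal f) (ht : t ∈ Icc 0 h)
    (hst : c * a * (s + t) < 1) :
    IsMonoBiLipschitz (1 - c * a * (s + t))⁻¹.toNNReal (someFlow (V (ρ₀.map f)) h t ∘ f) := by
  have := hf.isProbabilityMeasure_map ρ₀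
  refine (((isFlow_someFlow_map hV ha hf (ht.1.trans ht.2)).isMonoBiLipschitz
    (hV.lipschitzWith (hf.densityLE_map ha)) ht).comp hf).mono ?_
  have hs : 0 ≤ 1 - c * a * s := by
    linarith [mul_add (c * a : ℝ) s t, mul_nonneg (mul_nonneg c.coe_nonneg a.coe_nonneg) ht.1]
  rw [← Real.toNNReal_mul (inv_nonneg.2 hs)]
  refine Real.toNNReal_le_toNNReal ?_
  rw [NNReal.coe_mul, NNReal.coe_mul, Real.coe_toNNReal _ (inv_nonneg.2 hs), ← mul_assoc (c : ℝ)]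
  exact inv_mul_exp_le (c * a).coe_nonneg ht.1 hst

variable {T : ℝ} (hT : c * a * T < 1)

lemma mul_lt_one_of_le {b s T : ℝ} (hb : 0 ≤ b) (hs : s ≤ T) (hT : b * T < 1) : b * s < 1 :=
  (mul_le_mul_of_nonneg_left hs hb).trans_lt hT

include hV ha hT in
lemma isMonoBiLipschitz_eulerStep {h : ℝ} (hh : 0 < h) (k : ℕ) (hk : k * h ≤ T) :
    IsMonoBiLipschitz (1 - c * a * (k * h))⁻¹.toNNReal (eulerStep V ρ₀ h k) := by
  induction k with
  | zero => simpa [eulerStep] using IsMonoBiLipschitz.id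
  | succ k ih =>
    rw [Nat.cast_succ, add_one_mul] at hk ⊢
    exact isMonoBiLipschitz_someFlow_comp hV ha (ih (by linarith)) (right_mem_Icc.2 hh.le)
      (mul_lt_one_of_le (c * a).coe_nonneg hk hT)

include hV ha hT in
lemma isFlow_eulerStep {h : ℝ} (hh : 0 < h) (k : ℕ) (hk : k * h ≤ T) :
    IsFlow (V (ρ₀.map (eulerStep V ρ₀ h k))) h
      (someFlow (V (ρ₀.map (eulerStep V ρ₀ h k))) h) :=
  isFlow_someFlow_map hV ha (isMonoBiLipschitz_eulerStep hV ha hT hh k hk) hh.le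

include hV ha hT in
lemma isMonoBiLipschitz_eulerMap {h t : ℝ} (hh : 0 < h) (ht : t ∈ Icc 0 T) :
    IsMonoBiLipschitz (1 - c * a * T)⁻¹.toNNReal (eulerMap V ρ₀ h t) := by
  obtain ⟨k, s, hs, rfl⟩ := exists_eq_natCast_mul_add hh ht.1
  rw [eulerMap_add V ρ₀ hh k (Ico_subset_Icc_self hs)]
  refine (isMonoBiLipschitz_someFlow_comp hV ha (isMonoBiLipschitz_eulerStep hV ha hT hh k
    (by linarith [ht.2, hs.1])) (Ico_subset_Icc_self hs)
    (mul_lt_one_of_le (c * a).coe_nonneg ht.2 hT)).mono (Real.toNNReal_le_toNNReal ?_)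
  have : (c * a : ℝ) * (k * h + s) ≤ c * a * T := by gcongr; exact ht.2
  gcongr

include hV ha hT in
lemma lipschitzOnWith_eulerMap {h : ℝ} (hh : 0 < h) (x : ℝ) :
    LipschitzOnWith C (fun t => eulerMap V ρ₀ h t x) (Icc 0 T) := by
  have cell : ∀ k : ℕ, k * h ≤ T →
      LipschitzOnWith C (fun t => eulerMap V ρ₀ h t x) (Icc (k * h) (k * h + h)) := fun k hk => by
    have := (isMonoBiLipschitz_eulerStep hV ha hT hh k hk).isProbabilityMeasure_map ρ₀
    have hflow := (isFlow_eulerStep hV ha hT hh k hk).lipschitzOnWith (hV.bound _)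
      (eulerStep V ρ₀ h k x)
    refine LipschitzOnWith.of_dist_le_mul fun s hs t ht => ?_
    have hs' : s - k * h ∈ Icc 0 h := ⟨by linarith [hs.1], by linarith [hs.2]⟩
    have ht' : t - k * h ∈ Icc 0 h := ⟨by linarith [ht.1], by linarith [ht.2]⟩
    have := hflow.dist_le_mul _ hs' _ ht'
    rwa [dist_sub_right, ← Function.comp_apply (f := someFlow _ _ _),
      ← Function.comp_apply (f := someFlow _ _ (t - _)), ← eulerMap_add V ρ₀ hh k hs',
      ← eulerMap_add V ρ₀ hh k ht', add_sub_cancel, add_sub_cancel] at this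
  have glued : ∀ k : ℕ, k * h ≤ T →
      LipschitzOnWith C (fun t => eulerMap V ρ₀ h t x) (Icc 0 (k * h + h)) := fun k hk => by
    induction k with
    | zero => simpa using cell 0 hk
    | succ k ih =>
      refine lipschitzOnWith_Icc_of_Icc_of_Icc (ih ?_) ?_
      · rw [Nat.cast_succ] at hk; linarith
      · simpa [add_one_mul] using cell (k + 1) hk
  rcases lt_or_ge T 0 with hT0 | hT0
  · simp [Icc_eq_empty_of_lt hT0]
  obtain ⟨k, s, hs, hk⟩ := exists_eq_natCast_mul_add hh hT0
  exact (glued k (by linarith [hs.1])).mono (Icc_subset_Icc_right (by linarith [hs.2]))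

include hV ha hT in
lemma hasDerivWithinAt_eulerMap {h t : ℝ} (hh : 0 < h) (ht : t ∈ Icc 0 T) :
    ∃ τ ∈ Icc 0 T, |t - τ| ≤ h ∧ ∀ x, HasDerivWithinAt (fun t => eulerMap V ρ₀ h t x)
      (V (ρ₀.map (eulerMap V ρ₀ h τ)) (eulerMap V ρ₀ h t x)) (Ici t) t := by
  obtain ⟨k, s, hs, rfl⟩ := exists_eq_natCast_mul_add hh ht.1
  have hk : k * h ≤ T := by linarith [ht.2, hs.1]
  refine ⟨k * h, ⟨by positivity, hk⟩, ?_, fun x => ?_⟩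
  · rw [add_sub_cancel_left, abs_of_nonneg hs.1]; exact hs.2.le
  rw [eulerMap_natCast_mul V ρ₀ hh k, eulerMap_add V ρ₀ hh k (Ico_subset_Icc_self hs)]
  have hflow := hasDerivWithinAt_Ici_of_Icc hs
    ((isFlow_eulerStep hV ha hT hh k hk (eulerStep V ρ₀ h k x)).2 s (Ico_subset_Icc_self hs))
  have hshift := HasDerivWithinAt.scomp_of_eq (k * h + s) hflow
    ((hasDerivWithinAt_id _ (Ici (k * h + s))).sub_const (k * h))
    (fun y (hy : k * h + s ≤ y) => show s ≤ y - k * h by linarith) (by simp)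
  rw [one_smul] at hshift
  have hcell : ∀ y ∈ Icc (k * h + s) (k * h + h), eulerMap V ρ₀ h y x =
      someFlow (V (ρ₀.map (eulerStep V ρ₀ h k))) h (y - k * h) (eulerStep V ρ₀ h k x) :=
    fun y hy => by
      have := eulerMap_add V ρ₀ hh k (t := y - k * h)
        ⟨by linarith [hy.1, hs.1], by linarith [hy.2]⟩
      rw [add_sub_cancel] at this
      rw [this, Function.comp_apply]
  have hs_mem : k * h + s ∈ Icc (k * h + s) (k * h + h) := left_mem_Icc.2 (by linarith [hs.2])
  exact hshift.congr_of_eventuallyEq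
    (eventually_of_mem (Icc_mem_nhdsGE (by linarith [hs.2])) hcell) (hcell _ hs_mem)

end

/-! ### Comparison of approximate flows -/

section

variable {ι E : Type*} [NormedAddCommGroup E] {f : ℝ → ι → E} {a b s t : ℝ} {C : ℝ≥0}

lemma bddAbove_range_norm_of_lipschitzOnWith
    (hlip : ∀ i, LipschitzOnWith C (fun t => f t i) (Icc a b)) (hs : s ∈ Icc a b)
    (ht : t ∈ Icc a b) (h : BddAbove (range fun i => ‖f s i‖)) :
    BddAbove (range fun i => ‖f t i‖) := by
  obtain ⟨S, hS⟩ := h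
  refine ⟨S + C * dist t s, forall_mem_range.2 fun i => ?_⟩
  calc ‖f t i‖ ≤ ‖f s i‖ + ‖f t i - f s i‖ := norm_le_norm_add_norm_sub' _ _
    _ ≤ S + C * dist t s := by
        rw [← dist_eq_norm]
        exact add_le_add (hS (mem_range_self i)) ((hlip i).dist_le_mul t ht s hs)

lemma ciSup_norm_le_add_of_lipschitzOnWith [Nonempty ι]
    (hlip : ∀ i, LipschitzOnWith C (fun t => f t i) (Icc a b)) (hs : s ∈ Icc a b)
    (ht : t ∈ Icc a b) (h : BddAbove (range fun i => ‖f s i‖)) :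
    ⨆ i, ‖f t i‖ ≤ (⨆ i, ‖f s i‖) + C * dist t s := ciSup_le fun i =>
  calc ‖f t i‖ ≤ ‖f s i‖ + ‖f t i - f s i‖ := norm_le_norm_add_norm_sub' _ _
    _ ≤ _ := by
        rw [← dist_eq_norm]
        exact add_le_add (le_ciSup h i) ((hlip i).dist_le_mul t ht s hs)

variable [NormedSpace ℝ E] {f' : ℝ → ι → E} {δ K ε : ℝ}

lemma norm_le_gronwallBound_of_forall_norm_deriv_right_le
    (hlip : ∀ i, LipschitzOnWith C (fun t => f t i) (Icc a b))
    (hf' : ∀ t ∈ Ico a b, ∀ i, HasDerivWithinAt (fun t => f t i) (f' t i) (Ici t) t)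
    (ha : ∀ i, ‖f a i‖ ≤ δ)
    (bound : ∀ t ∈ Ico a b, ∀ S, (∀ j, ‖f t j‖ ≤ S) → ∀ i, ‖f' t i‖ ≤ K * S + ε)
    (ht : t ∈ Icc a b) (i : ι) : ‖f t i‖ ≤ gronwallBound δ K ε (t - a) := by
  have : Nonempty ι := ⟨i⟩
  have hbdd : ∀ s ∈ Icc a b, BddAbove (range fun i => ‖f s i‖) := fun s hs =>
    bddAbove_range_norm_of_lipschitzOnWith hlip (left_mem_Icc.2 (ht.1.trans ht.2)) hs
      ⟨δ, forall_mem_range.2 ha⟩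
  set D : ℝ → ℝ := fun s => ⨆ i, ‖f s i‖
  have hD : ∀ s ∈ Icc a b, ∀ r ∈ Icc a b, D s ≤ D r + C * dist s r := fun s hs r hr =>
    ciSup_norm_le_add_of_lipschitzOnWith hlip hr hs (hbdd r hr)
  have slope_le : ∀ s ∈ Ico a b, ∀ z ∈ Ioo s b,
      (z - s)⁻¹ * (D z - D s) ≤ K * (D s + C * (z - s)) + ε := fun s hs z hz => by
    have hsz : Icc s z ⊆ Icc a b := Icc_subset_Icc hs.1 hz.2.le
    rw [inv_mul_le_iff₀ (sub_pos.2 hz.1), sub_le_iff_le_add']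
    refine ciSup_le fun i => (norm_le_norm_add_norm_sub' _ (f s i)).trans
      (add_le_add (le_ciSup (hbdd s (Ico_subset_Icc_self hs)) i) ?_)
    rw [mul_comm]
    refine norm_image_sub_le_of_norm_deriv_right_le_segment
      ((hlip i).continuousOn.mono hsz) (fun r hr => hf' r ⟨hs.1.trans hr.1, hr.2.trans hz.2⟩ i)
      (fun r hr => ?_) z (right_mem_Icc.2 hz.1.le)
    have hr' := hsz (Ico_subset_Icc_self hr)
    refine bound r ⟨hr'.1, hr.2.trans hz.2⟩ _ (fun j => ?_) i
    calc ‖f r j‖ ≤ D s + C * dist r s :=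
          (le_ciSup (hbdd r hr') j).trans (hD r hr' s (Ico_subset_Icc_self hs))
      _ ≤ D s + C * (z - s) := by
          rw [Real.dist_eq, abs_of_nonneg (sub_nonneg.2 hr.1)]
          gcongr
          exact hr.2.le
  refine (le_ciSup (hbdd t ht) i).trans (le_gronwallBound_of_liminf_deriv_right_le (f := D)
    (f' := fun s => K * D s + ε) (LipschitzOnWith.of_le_add_mul C hD).continuousOn
    (fun s hs r hr => Eventually.frequently ?_) (ciSup_le ha) (fun _ _ => le_rfl) t ht)
  have hlim : Tendsto (fun z => K * (D s + C * (z - s)) + ε) (𝓝[>] s) (𝓝 (K * D s + ε)) := by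
    refine ((Continuous.tendsto ?_ s).mono_left nhdsWithin_le_nhds).trans_eq ?_
    · fun_prop
    · simp
  filter_upwards [Ioo_mem_nhdsGT hs.2, hlim.eventually_lt_const hr] with z hz hzr
  exact (slope_le s hs z hz).trans_lt hzr

end

/-- `X t`, for `t ∈ [0,T]`, are increasing `κ`-bi-Lipschitz maps moving with speed at most `C` along
the velocity field generated by the image of `ρ₀` at some time within `ε` of the current one. -/
structure IsApproxFlow (V : Measure ℝ → ℝ → ℝ) (ρ₀ : Measure ℝ) (κ C : ℝ≥0) (T ε : ℝ)
    (X : ℝ → ℝ → ℝ) : Prop where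
  zero : X 0 = id
  isMonoBiLipschitz : ∀ t ∈ Icc 0 T, IsMonoBiLipschitz κ (X t)
  lipschitzOnWith : ∀ x, LipschitzOnWith C (fun t => X t x) (Icc 0 T)
  exists_hasDerivWithinAt : ∀ t ∈ Ico 0 T, ∃ τ ∈ Icc 0 T, |t - τ| ≤ ε ∧ ∀ x,
    HasDerivWithinAt (fun t => X t x) (V (ρ₀.map (X τ)) (X t x)) (Ici t) t

section

variable {V : Measure ℝ → ℝ → ℝ} {c C : ℝ≥0} (hV : IsNonlocalField V c C) {ρ₀ : Measure ℝ}
  [IsProbabilityMeasure ρ₀] {a κ : ℝ≥0} (ha : DensityLE a ρ₀) {T : ℝ}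

include hV ha in
lemma isApproxFlow_eulerMap (hT : c * a * T < 1) {h : ℝ} (hh : 0 < h) :
    IsApproxFlow V ρ₀ (1 - c * a * T)⁻¹.toNNReal C T h (eulerMap V ρ₀ h) where
  zero := eulerMap_zero V ρ₀ hh
  isMonoBiLipschitz _ := isMonoBiLipschitz_eulerMap hV ha hT hh
  lipschitzOnWith := lipschitzOnWith_eulerMap hV ha hT hh
  exists_hasDerivWithinAt _ ht := hasDerivWithinAt_eulerMap hV ha hT hh (Ico_subset_Icc_self ht)

include hV ha in
lemma IsNonlocalField.abs_map_sub_map_le_of_isMonoBiLipschitz {f g : ℝ → ℝ}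
    (hf : IsMonoBiLipschitz κ f) (hg : Measurable g) {d : ℝ} (hfg : ∀ x, |f x - g x| ≤ d)
    (x y : ℝ) : |V (ρ₀.map f) x - V (ρ₀.map g) y| ≤ c * (a * κ) * (|x - y| + d) := by
  have := hf.isProbabilityMeasure_map ρ₀
  have := Measure.isProbabilityMeasure_map (μ := ρ₀) hg.aemeasurable
  have hclose := cdfDistLE_map hf.measurable hg (hf.densityLE_map ha) (ae_of_all _ hfg)
  refine (hV.abs_sub_le_of_cdfDistLE (hf.densityLE_map ha) hclose x y).trans_eq ?_
  push_cast
  ring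

variable {ε ε' d : ℝ} {X Y : ℝ → ℝ → ℝ}

omit [IsProbabilityMeasure ρ₀] in
lemma IsApproxFlow.abs_sub_le_of_abs_sub_le (hX : IsApproxFlow V ρ₀ κ C T ε X) {s t x y d : ℝ}
    (hs : s ∈ Icc 0 T) (ht : t ∈ Icc 0 T) (hst : |t - s| ≤ ε) (hd : |X t x - y| ≤ d) :
    |X s x - y| ≤ d + C * ε := by
  have hlip := (hX.lipschitzOnWith x).dist_le_mul s hs t ht
  rw [Real.dist_eq, Real.dist_eq, abs_sub_comm s] at hlip
  linarith [abs_sub_le (X s x) (X t x) y, mul_le_mul_of_nonneg_left hst C.coe_nonneg]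

include hV ha in
lemma IsApproxFlow.abs_sub_le_gronwallBound (hX : IsApproxFlow V ρ₀ κ C T ε X)
    (hY : IsApproxFlow V ρ₀ κ C T ε' Y) {t : ℝ} (ht : t ∈ Icc 0 T) (x : ℝ) :
    |X t x - Y t x| ≤
      gronwallBound 0 (2 * (c * (a * κ))) (c * (a * κ) * (C * (ε + ε'))) t := by
  choose! τ hτ hτε hX' using hX.exists_hasDerivWithinAt
  choose! τ' hτ' hτε' hY' using hY.exists_hasDerivWithinAt
  have := norm_le_gronwallBound_of_forall_norm_deriv_right_le (f := fun t x => X t x - Y t x)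
    (δ := 0) (K := 2 * (c * (a * κ))) (ε := c * (a * κ) * (C * (ε + ε')))
    (fun x => (hX.lipschitzOnWith x).sub (hY.lipschitzOnWith x))
    (fun s hs x => (hX' s hs x).sub (hY' s hs x)) (by simp [hX.zero, hY.zero])
    (fun s hs S hS x => ?_) ht x
  · rwa [sub_zero] at this
  have hs' := Ico_subset_Icc_self hs
  have hfrozen : ∀ y, |X (τ s) y - Y (τ' s) y| ≤ S + C * ε + C * ε' := fun y => by
    rw [abs_sub_comm]
    refine hY.abs_sub_le_of_abs_sub_le (hτ' s hs) hs' (hτε' s hs) ?_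
    rw [abs_sub_comm]
    exact hX.abs_sub_le_of_abs_sub_le (hτ s hs) hs' (hτε s hs) (hS y)
  calc _ ≤ c * (a * κ) * (|X s x - Y s x| + (S + C * ε + C * ε')) :=
        hV.abs_map_sub_map_le_of_isMonoBiLipschitz ha (hX.isMonoBiLipschitz _ (hτ s hs))
          (hY.isMonoBiLipschitz _ (hτ' s hs)).measurable hfrozen _ _
    _ ≤ c * (a * κ) * (S + (S + C * ε + C * ε')) := by gcongr; exact hS x
    _ = _ := by ring

end

/-! ### Lagrangian solutions -/

/-- `X t` are increasing `κ`-bi-Lipschitz maps moving with speed at most `C`, along the velocity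
field generated by the image of `ρ₀` when `t ∈ (0,T)`. The other conditions are imposed at all
times, so that `X` is jointly continuous. -/
structure IsLagrangianSolution (V : Measure ℝ → ℝ → ℝ) (ρ₀ : Measure ℝ) (κ C : ℝ≥0) (T : ℝ)
    (X : ℝ → ℝ → ℝ) : Prop where
  zero : X 0 = id
  isMonoBiLipschitz : ∀ t, IsMonoBiLipschitz κ (X t)
  lipschitzWith : ∀ x, LipschitzWith C fun t => X t x
  hasDerivAt : ∀ t ∈ Ioo 0 T, ∀ x, HasDerivAt (fun t => X t x) (V (ρ₀.map (X t)) (X t x)) t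

lemma gronwallBound_zero_eq_mul (K ε x : ℝ) :
    gronwallBound 0 K ε x = ε * gronwallBound 0 K 1 x := by
  unfold gronwallBound
  split_ifs <;> ring

lemma exists_forall_dist_le_mul_of_dist_le_mul_add {E : Type*} [MetricSpace E] [CompleteSpace E]
    {u : ℕ → E} {ε : ℕ → ℝ} (hε : Tendsto ε atTop (𝓝 0)) {B : ℝ}
    (h : ∀ n m, dist (u n) (u m) ≤ B * (ε n + ε m)) : ∃ l, ∀ n, dist (u n) l ≤ B * ε n := by
  have hsmall : Tendsto (fun p : ℕ × ℕ => B * (ε p.1 + ε p.2)) atTop (𝓝 0) := by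
    rw [← prod_atTop_atTop_eq]
    simpa using ((hε.comp tendsto_fst).add (hε.comp tendsto_snd)).const_mul B
  have hu : CauchySeq u := cauchySeq_iff_tendsto_dist_atTop_0.2
    (squeeze_zero (fun _ => dist_nonneg) (fun p => h p.1 p.2) hsmall)
  obtain ⟨l, hl⟩ := cauchySeq_tendsto_of_complete hu
  refine ⟨l, fun n => le_of_tendsto_of_tendsto' (tendsto_const_nhds.dist hl) ?_ fun m => h n m⟩
  simpa using (hε.const_add (ε n)).const_mul B

section

variable {V : Measure ℝ → ℝ → ℝ} {c C : ℝ≥0} (hV : IsNonlocalField V c C) {ρ₀ : Measure ℝ}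
  [IsProbabilityMeasure ρ₀] {a κ : ℝ≥0} (ha : DensityLE a ρ₀) {T : ℝ}

include hV ha in
lemma continuous_velocity_along {X : ℝ → ℝ → ℝ} (hX : ∀ t, IsMonoBiLipschitz κ (X t))
    (hlip : ∀ x, LipschitzWith C fun t => X t x) (x : ℝ) :
    Continuous fun t => V (ρ₀.map (X t)) (X t x) := by
  refine LipschitzWith.continuous (K := c * (a * κ) * (C + C))
    (LipschitzWith.of_dist_le_mul fun s t => ?_)
  calc _ ≤ c * (a * κ) * (|X s x - X t x| + C * |s - t|) :=
        hV.abs_map_sub_map_le_of_isMonoBiLipschitz ha (hX s) (hX t).measurable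
          (fun y => (hlip y).dist_le_mul s t) _ _
    _ ≤ c * (a * κ) * (C * |s - t| + C * |s - t|) := by
        gcongr
        exact (hlip x).dist_le_mul s t
    _ = _ := by push_cast [Real.dist_eq]; ring

include hV ha in
lemma IsApproxFlow.abs_sub_integral_le {X Y : ℝ → ℝ → ℝ} {ε d : ℝ}
    (hX : IsApproxFlow V ρ₀ κ C T ε X) (hY : ∀ t, IsMonoBiLipschitz κ (Y t))
    (hYlip : ∀ x, LipschitzWith C fun t => Y t x) (hXY : ∀ t ∈ Icc 0 T, ∀ x, |X t x - Y t x| ≤ d)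
    {t : ℝ} (ht : t ∈ Icc 0 T) (x : ℝ) :
    |X t x - (x + ∫ s in (0 : ℝ)..t, V (ρ₀.map (Y s)) (Y s x))| ≤
      c * (a * κ) * (2 * d + C * ε) * t := by
  have hcont := continuous_velocity_along hV ha hY hYlip x
  have hint : ∀ s, HasDerivAt (fun t => x + ∫ s in (0 : ℝ)..t, V (ρ₀.map (Y s)) (Y s x))
      (V (ρ₀.map (Y s)) (Y s x)) s := fun s =>
    (hcont.integral_hasStrictDerivAt 0 s).hasDerivAt.const_add x
  choose! τ hτ hτε hX' using hX.exists_hasDerivWithinAt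
  have := norm_image_sub_le_of_norm_deriv_right_le_segment
    ((hX.lipschitzOnWith x).continuousOn.sub fun s _ => (hint s).continuousAt.continuousWithinAt)
    (fun s hs => (hX' s hs x).sub (hint s).hasDerivWithinAt)
    (C := c * (a * κ) * (2 * d + C * ε)) (fun s hs => ?_) t ht
  · simpa [hX.zero] using this
  have hs' := Ico_subset_Icc_self hs
  calc _ ≤ c * (a * κ) * (|X s x - Y s x| + (d + C * ε)) := by
        refine hV.abs_map_sub_map_le_of_isMonoBiLipschitz ha (hX.isMonoBiLipschitz _ (hτ s hs))
          (hY s).measurable (fun y => ?_) _ _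
        exact hX.abs_sub_le_of_abs_sub_le (hτ s hs) hs' (hτε s hs) (hXY s hs' y)
    _ ≤ c * (a * κ) * (d + (d + C * ε)) := by gcongr; exact hXY s hs' x
    _ = _ := by ring

include hV ha in
lemma exists_limit_of_isApproxFlow {ε : ℕ → ℝ} (hε0 : ∀ n, 0 ≤ ε n)
    (hε : Tendsto ε atTop (𝓝 0)) {X : ℕ → ℝ → ℝ → ℝ}
    (hX : ∀ n, IsApproxFlow V ρ₀ κ C T (ε n) (X n)) :
    ∃ (Y : ℝ → ℝ → ℝ) (B : ℝ), ∀ n, ∀ t ∈ Icc 0 T, ∀ x, |X n t x - Y t x| ≤ B * ε n := by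
  set K : ℝ := c * (a * κ)
  set B : ℝ := K * C * gronwallBound 0 (2 * K) 1 T with hB
  have hcomp : ∀ t ∈ Icc 0 T, ∀ x n m, dist (X n t x) (X m t x) ≤ B * (ε n + ε m) :=
    fun t ht x n m => by
      have hεnm := add_nonneg (hε0 n) (hε0 m)
      calc _ ≤ gronwallBound 0 (2 * K) (K * (C * (ε n + ε m))) t :=
            (hX n).abs_sub_le_gronwallBound hV ha (hX m) ht x
        _ ≤ gronwallBound 0 (2 * K) (K * (C * (ε n + ε m))) T :=
            gronwallBound_mono le_rfl (by positivity) (by positivity) ht.2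
        _ = _ := by rw [gronwallBound_zero_eq_mul, hB]; ring
  choose! Y hY using fun t (ht : t ∈ Icc 0 T) x =>
    exists_forall_dist_le_mul_of_dist_le_mul_add hε (hcomp t ht x)
  exact ⟨Y, B, fun n t ht x => hY t ht x n⟩

include hV ha in
lemma isLagrangianSolution_of_tendsto (hT : 0 ≤ T) {ε d : ℕ → ℝ} (hε : Tendsto ε atTop (𝓝 0))
    (hd : Tendsto d atTop (𝓝 0)) {X : ℕ → ℝ → ℝ → ℝ}
    (hX : ∀ n, IsApproxFlow V ρ₀ κ C T (ε n) (X n)) {Y : ℝ → ℝ → ℝ}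
    (hXY : ∀ n, ∀ t ∈ Icc 0 T, ∀ x, |X n t x - Y t x| ≤ d n) :
    IsLagrangianSolution V ρ₀ κ C T fun t => Y (projIcc 0 T hT t) := by
  have hlim : ∀ t x, Tendsto (fun n => X n (projIcc 0 T hT t) x) atTop
      (𝓝 (Y (projIcc 0 T hT t) x)) := fun t x =>
    tendsto_iff_dist_tendsto_zero.2 (squeeze_zero (fun _ => dist_nonneg)
      (fun n => hXY n _ (projIcc 0 T hT t).2 x) hd)
  have hbi : ∀ t, IsMonoBiLipschitz κ (Y (projIcc 0 T hT t)) := fun t =>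
    .of_tendsto (fun n => (hX n).isMonoBiLipschitz _ (projIcc 0 T hT t).2) (hlim t)
  have hlip : ∀ x, LipschitzWith C fun t => Y (projIcc 0 T hT t) x := fun x =>
    LipschitzWith.of_dist_le_mul fun s t =>
      le_of_tendsto' ((hlim s x).dist (hlim t x)) fun n =>
        (((hX n).lipschitzOnWith x).dist_le_mul _ (projIcc 0 T hT s).2 _
          (projIcc 0 T hT t).2).trans (by gcongr; exact abs_projIcc_sub_projIcc hT)
  have hinit : Y (projIcc 0 T hT 0) = id := funext fun x =>
    tendsto_nhds_unique (hlim 0 x) (by simp [projIcc_left, (hX _).zero])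
  have hintegral : ∀ t ∈ Icc 0 T, ∀ x, Y (projIcc 0 T hT t) x =
      x + ∫ s in (0 : ℝ)..t, V (ρ₀.map (Y (projIcc 0 T hT s))) (Y (projIcc 0 T hT s) x) :=
    fun t ht x => by
      have hzero : Tendsto (fun n => c * (a * κ) * (2 * d n + C * ε n) * t) atTop (𝓝 0) := by
        simpa using (((hd.const_mul 2).add (hε.const_mul (C : ℝ))).const_mul
          (c * (a * κ) : ℝ)).mul_const t
      have hclose : ∀ n, ∀ s ∈ Icc 0 T, ∀ y, |X n s y - Y (projIcc 0 T hT s) y| ≤ d n :=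
        fun n s hs y => by rw [projIcc_of_mem hT hs]; exact hXY n s hs y
      refine tendsto_nhds_unique (hlim t x) (tendsto_iff_dist_tendsto_zero.2
        (squeeze_zero (fun _ => dist_nonneg) (fun n => ?_) hzero))
      rw [projIcc_of_mem hT ht]
      exact (hX n).abs_sub_integral_le hV ha hbi hlip (hclose n) ht x
  refine ⟨hinit, hbi, hlip, fun t ht x => ?_⟩
  have hcont := continuous_velocity_along hV ha hbi hlip x
  refine ((hcont.integral_hasStrictDerivAt 0 t).hasDerivAt.const_add x).congr_of_eventuallyEq ?_
  exact eventually_of_mem (Icc_mem_nhds ht.1 ht.2) fun s hs => hintegral s hs x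

end

/-! ### Push-forward curves -/

lemma Winf_map_le {μ : Measure ℝ} {f g : ℝ → ℝ} (hf : Measurable f) (hg : Measurable g)
    {d : ℝ} (hd : ∀ x, |f x - g x| ≤ d) : Winf (μ.map f) (μ.map g) ≤ ENNReal.ofReal d := by
  have hfg : Measurable fun x => (f x, g x) := hf.prodMk hg
  refine iInf₂_le_of_le (μ.map fun x => (f x, g x))
    ⟨Measure.map_map measurable_fst hfg, Measure.map_map measurable_snd hfg⟩
    (essSup_le_of_ae_le _ ?_)
  rw [EventuallyLE, ae_map_iff hfg.aemeasurable (measurableSet_le (by fun_prop) (by fun_prop))]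
  exact ae_of_all _ fun x => by
    rw [edist_dist, Real.dist_eq]
    exact ENNReal.ofReal_le_ofReal (hd x)

lemma IsMonoBiLipschitz.isBddDensity_map {κ : ℝ≥0} {f : ℝ → ℝ} (hf : IsMonoBiLipschitz κ f)
    {μ : Measure ℝ} (h : IsBddDensity μ) : IsBddDensity (μ.map f) := by
  have := h.prob
  have := hf.isProbabilityMeasure_map μ
  obtain ⟨S, hS, hS0⟩ := h.compact_supp
  have hfS := hS.image hf.lipschitz.continuous
  refine isBddDensity_of_densityLE (hf.densityLE_map h.densityLE) hfS ?_
  rw [Measure.map_apply hf.measurable hfS.measurableSet.compl]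
  exact measure_mono_null (fun x hx hxS => hx (mem_image_of_mem f hxS)) hS0

lemma isContCurve_map {μ : Measure ℝ} (h : IsBddDensity μ) {κ C : ℝ≥0} {T : ℝ} {X : ℝ → ℝ → ℝ}
    (hX : ∀ t ∈ Icc 0 T, IsMonoBiLipschitz κ (X t))
    (hlip : ∀ x, LipschitzOnWith C (fun t => X t x) (Icc 0 T)) :
    IsContCurve T fun t => μ.map (X t) where
  mem t ht := (hX t ht).isBddDensity_map h
  cont s hs := by
    have hdist : Tendsto (fun t => ENNReal.ofReal (C * dist s t)) (𝓝[Icc 0 T] s) (𝓝 0) := by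
      refine ((Continuous.tendsto ?_ s).mono_left nhdsWithin_le_nhds).trans_eq ?_
      · exact ENNReal.continuous_ofReal.comp (by fun_prop)
      · simp
    exact tendsto_of_tendsto_of_tendsto_of_le_of_le' tendsto_const_nhds hdist
      (Eventually.of_forall fun _ => zero_le) (eventually_mem_nhdsWithin.mono fun t ht =>
        Winf_map_le (hX s hs).measurable (hX t ht).measurable fun x =>
          (hlip x).dist_le_mul s hs t ht)

lemma isEulerTrajectory_eulerMap {v w : ℝ → ℝ} {c C : ℝ≥0}
    (hV : IsNonlocalField (velocity v w) c C) {ρ₀ : Measure ℝ} [IsProbabilityMeasure ρ₀]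
    {a : ℝ≥0} (ha : DensityLE a ρ₀) {T : ℝ} (hT : 0 < T) (hcT : c * a * T < 1) (n : ℕ) :
    IsEulerTrajectory v w ρ₀ T n fun t => ρ₀.map (eulerMap (velocity v w) ρ₀ (T / 2 ^ n) t) := by
  have hh : 0 < T / 2 ^ n := by positivity
  refine ⟨by simp only [eulerMap_zero _ ρ₀ hh, Measure.map_id], fun k hk => ?_⟩
  have hkT : k * (T / 2 ^ n) ≤ T := by
    have : (k : ℝ) ≤ 2 ^ n := by exact_mod_cast hk.le
    calc k * (T / 2 ^ n) ≤ 2 ^ n * (T / 2 ^ n) := by gcongr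
      _ = T := by field_simp
  have hflow := isFlow_eulerStep hV ha hcT hh k hkT
  have hstep := isMonoBiLipschitz_eulerStep hV ha hcT hh k hkT
  have := hstep.isProbabilityMeasure_map ρ₀
  refine ⟨someFlow (velocity v w (ρ₀.map (eulerStep (velocity v w) ρ₀ (T / 2 ^ n) k)))
    (T / 2 ^ n), ?_, fun t ht => ?_⟩
  · simpa only [eulerMap_natCast_mul _ ρ₀ hh k] using hflow
  · simp only [eulerMap_natCast_mul _ ρ₀ hh k, eulerMap_add _ ρ₀ hh k ht]
    exact (Measure.map_map (hflow.isMonoBiLipschitz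
      (hV.lipschitzWith (hstep.densityLE_map ha)) ht).measurable hstep.measurable).symm

/-! ### Lagrangian solutions are weak solutions -/

namespace IsTestFun

variable {T : ℝ} {φ : ℝ × ℝ → ℝ} (hφ : IsTestFun T φ)

include hφ

lemma hasFDerivAt (p : ℝ × ℝ) : HasFDerivAt φ (fderiv ℝ φ p) p :=
  (hφ.smooth.differentiable (by simp) p).hasFDerivAt

lemma deriv_fst (t x : ℝ) : deriv (fun s => φ (s, x)) t = fderiv ℝ φ (t, x) (1, 0) :=
  (HasFDerivAt.comp_hasDerivAt t (hφ.hasFDerivAt (t, x))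
    ((hasDerivAt_id t).prodMk (hasDerivAt_const t x))).deriv

lemma deriv_snd (t x : ℝ) : deriv (fun z => φ (t, z)) x = fderiv ℝ φ (t, x) (0, 1) :=
  (HasFDerivAt.comp_hasDerivAt x (hφ.hasFDerivAt (t, x))
    ((hasDerivAt_const x t).prodMk (hasDerivAt_id x))).deriv

lemma hasDerivAt_comp {X : ℝ → ℝ} {X' t : ℝ} (hX : HasDerivAt X X' t) :
    HasDerivAt (fun t => φ (t, X t))
      (fderiv ℝ φ (t, X t) (1, 0) + X' * fderiv ℝ φ (t, X t) (0, 1)) t := by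
  refine ((hφ.hasFDerivAt (t, X t)).comp_hasDerivAt t
    ((hasDerivAt_id t).prodMk hX)).congr_deriv ?_
  rw [← smul_eq_mul X', ← map_smul, ← map_add]
  simp

lemma eq_zero {t : ℝ} (ht : t ∉ Ioo 0 T) (x : ℝ) : φ (t, x) = 0 :=
  image_eq_zero_of_notMem_tsupport fun h => ht (hφ.supp h).1

lemma continuous_fderiv (e : ℝ × ℝ) : Continuous fun p => fderiv ℝ φ p e :=
  (hφ.smooth.continuous_fderiv (by simp)).clm_apply continuous_const

lemma exists_abs_fderiv_le (e : ℝ × ℝ) : ∃ A, ∀ p, |fderiv ℝ φ p e| ≤ A :=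
  HasCompactSupport.exists_bound_of_continuous
    ((hφ.compact.fderiv ℝ).comp_left (g := fun L : ℝ × ℝ →L[ℝ] ℝ => L e) (by simp))
    (hφ.continuous_fderiv e)

end IsTestFun

namespace IsLagrangianSolution

variable {V : Measure ℝ → ℝ → ℝ} {c C κ : ℝ≥0} {T : ℝ} {ρ₀ : Measure ℝ} {X : ℝ → ℝ → ℝ}

lemma continuous (hX : IsLagrangianSolution V ρ₀ κ C T X) :
    Continuous fun p : ℝ × ℝ => X p.1 p.2 :=
  continuous_prod_of_continuous_lipschitzWith _ C
    (fun t => (hX.isMonoBiLipschitz t).lipschitz.continuous) hX.lipschitzWith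

variable [IsProbabilityMeasure ρ₀]

lemma continuous_velocity (hV : IsNonlocalField V c C) {a : ℝ≥0} (ha : DensityLE a ρ₀)
    (hX : IsLagrangianSolution V ρ₀ κ C T X) :
    Continuous fun p : ℝ × ℝ => V (ρ₀.map (X p.1)) (X p.1 p.2) := by
  have hV_lip : ∀ t, LipschitzWith (c * (a * κ)) (V (ρ₀.map (X t))) := fun t =>
    have := (hX.isMonoBiLipschitz t).isProbabilityMeasure_map ρ₀
    hV.lipschitzWith ((hX.isMonoBiLipschitz t).densityLE_map ha)
  exact continuous_prod_of_continuous_lipschitzWith' _ (c * (a * κ) * κ)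
    (fun t => (hV_lip t).comp (hX.isMonoBiLipschitz t).lipschitz)
    (continuous_velocity_along hV ha hX.isMonoBiLipschitz hX.lipschitzWith)

variable {φ : ℝ × ℝ → ℝ}

lemma continuous_deriv_comp (hV : IsNonlocalField V c C) {a : ℝ≥0} (ha : DensityLE a ρ₀)
    (hX : IsLagrangianSolution V ρ₀ κ C T X) (hφ : IsTestFun T φ) :
    Continuous fun p : ℝ × ℝ => fderiv ℝ φ (p.1, X p.1 p.2) (1, 0) +
      V (ρ₀.map (X p.1)) (X p.1 p.2) * fderiv ℝ φ (p.1, X p.1 p.2) (0, 1) := by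
  have hpair : Continuous fun p : ℝ × ℝ => (p.1, X p.1 p.2) :=
    continuous_fst.prodMk hX.continuous
  exact ((hφ.continuous_fderiv (1, 0)).comp hpair).add
    ((hX.continuous_velocity hV ha).mul ((hφ.continuous_fderiv (0, 1)).comp hpair))

lemma integrable_deriv_comp (hV : IsNonlocalField V c C) {a : ℝ≥0} (ha : DensityLE a ρ₀)
    (hX : IsLagrangianSolution V ρ₀ κ C T X) (hφ : IsTestFun T φ) :
    Integrable (fun p : ℝ × ℝ => fderiv ℝ φ (p.1, X p.1 p.2) (1, 0) +
      V (ρ₀.map (X p.1)) (X p.1 p.2) * fderiv ℝ φ (p.1, X p.1 p.2) (0, 1))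
      ((volume.restrict (Ioc 0 T)).prod ρ₀) := by
  obtain ⟨A, hA⟩ := hφ.exists_abs_fderiv_le (1, 0)
  obtain ⟨B, hB⟩ := hφ.exists_abs_fderiv_le (0, 1)
  refine Integrable.of_bound (hX.continuous_deriv_comp hV ha hφ).aestronglyMeasurable (A + C * B)
    (ae_of_all _ fun p => ?_)
  have := (hX.isMonoBiLipschitz p.1).isProbabilityMeasure_map ρ₀
  refine (norm_add_le _ _).trans (add_le_add (hA _) ?_)
  rw [norm_mul]
  exact mul_le_mul (hV.bound _ _) (hB _) (norm_nonneg _) C.coe_nonneg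

lemma integral_deriv_comp_eq_zero (hV : IsNonlocalField V c C) {a : ℝ≥0} (ha : DensityLE a ρ₀)
    (hX : IsLagrangianSolution V ρ₀ κ C T X) (hφ : IsTestFun T φ) (hT : 0 ≤ T) (x : ℝ) :
    ∫ t in (0 : ℝ)..T, (fderiv ℝ φ (t, X t x) (1, 0) +
      V (ρ₀.map (X t)) (X t x) * fderiv ℝ φ (t, X t x) (0, 1)) = 0 := by
  have hcont : Continuous fun t => φ (t, X t x) :=
    hφ.smooth.continuous.comp (continuous_id.prodMk (hX.lipschitzWith x).continuous)
  rw [intervalIntegral.integral_eq_sub_of_hasDerivAt_of_le hT hcont.continuousOn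
    (fun t ht => hφ.hasDerivAt_comp (hX.hasDerivAt t ht x))
    (((hX.continuous_deriv_comp hV ha hφ).comp (.prodMk_left x)).intervalIntegrable _ _)]
  simp [hφ.eq_zero]

lemma integral_eq_zero (hV : IsNonlocalField V c C) {a : ℝ≥0} (ha : DensityLE a ρ₀)
    (hX : IsLagrangianSolution V ρ₀ κ C T X) (hφ : IsTestFun T φ) (hT : 0 ≤ T) :
    ∫ t in (0 : ℝ)..T, ∫ x, (deriv (fun s => φ (s, x)) t
      + V (ρ₀.map (X t)) x * deriv (fun z => φ (t, z)) x) ∂(ρ₀.map (X t)) = 0 := by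
  have change_variables : ∀ t, ∫ x, (deriv (fun s => φ (s, x)) t
      + V (ρ₀.map (X t)) x * deriv (fun z => φ (t, z)) x) ∂(ρ₀.map (X t)) =
      ∫ x, (fderiv ℝ φ (t, X t x) (1, 0) +
        V (ρ₀.map (X t)) (X t x) * fderiv ℝ φ (t, X t x) (0, 1)) ∂ρ₀ := fun t => by
    have hX_t := hX.isMonoBiLipschitz t
    rw [(hX_t.lipschitz.continuous.measurableEmbedding hX_t.antilipschitz.injective).integral_map]
    simp only [hφ.deriv_fst, hφ.deriv_snd]
  have hzero := hX.integral_deriv_comp_eq_zero hV ha hφ hT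
  simp only [intervalIntegral.integral_of_le hT] at hzero
  rw [intervalIntegral.integral_of_le hT, integral_congr_ae (ae_of_all _ change_variables),
    integral_integral_swap (hX.integrable_deriv_comp hV ha hφ)]
  simp only [hzero, integral_zero]

lemma isWeakSolution {v w : ℝ → ℝ} (hV : IsNonlocalField (velocity v w) c C)
    (h : IsBddDensity ρ₀) (hT : 0 ≤ T) (hX : IsLagrangianSolution (velocity v w) ρ₀ κ C T X) :
    IsWeakSolution v w ρ₀ T fun t => ρ₀.map (X t) where
  curve := isContCurve_map h (fun t _ => hX.isMonoBiLipschitz t) fun x =>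
    (hX.lipschitzWith x).lipschitzOnWith
  init := by simp only [hX.zero, Measure.map_id]
  weak _ hφ := hX.integral_eq_zero hV h.densityLE hφ hT

end IsLagrangianSolution

/-! ### Continuity with respect to the `∞`-Wasserstein distance -/

section Winf

variable {μ ν : Measure ℝ} {r : ℝ}

lemma exists_isPlan_of_Winf_lt (h : Winf μ ν < ENNReal.ofReal r) :
    ∃ π, IsPlan π μ ν ∧ ∀ᵐ p ∂π, |p.1 - p.2| ≤ r := by
  obtain ⟨π, h⟩ := iInf_lt_iff.1 h
  obtain ⟨hπ, hlt⟩ := iInf_lt_iff.1 h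
  refine ⟨π, hπ, ?_⟩
  filter_upwards [ENNReal.ae_le_essSup (μ := π) fun p : ℝ × ℝ => edist p.1 p.2] with p hp
  have hdist := hp.trans_lt hlt
  rw [edist_dist, Real.dist_eq, ENNReal.ofReal_lt_ofReal_iff_of_nonneg (abs_nonneg _)] at hdist
  exact hdist.le

lemma IsPlan.isProbabilityMeasure {π : Measure (ℝ × ℝ)} [IsProbabilityMeasure μ]
    (h : IsPlan π μ ν) : IsProbabilityMeasure π := by
  have : IsProbabilityMeasure (π.map Prod.fst) := by rwa [h.1]
  exact Measure.isProbabilityMeasure_of_map Prod.fst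

lemma ae_mem_Icc_of_Winf_lt {R : ℝ} (h : Winf μ ν < ENNReal.ofReal r)
    (hR : ∀ᵐ x ∂μ, x ∈ Icc (-R) R) : ∀ᵐ y ∂ν, y ∈ Icc (-(R + r)) (R + r) := by
  obtain ⟨π, hπ, hπr⟩ := exists_isPlan_of_Winf_lt h
  rw [← hπ.1] at hR
  rw [← hπ.2]
  refine (ae_map_iff measurable_snd.aemeasurable measurableSet_Icc).2 ?_
  filter_upwards [ae_of_ae_map measurable_fst.aemeasurable hR, hπr] with p hp hpr
  rw [abs_le] at hpr
  constructor <;> linarith [hp.1, hp.2]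

lemma cdfDistLE_of_Winf_lt [IsProbabilityMeasure μ] {M : ℝ≥0} (hM : DensityLE M μ)
    (h : Winf μ ν < ENNReal.ofReal r) : CdfDistLE (M * r) μ ν := by
  obtain ⟨π, hπ, hπr⟩ := exists_isPlan_of_Winf_lt h
  have := hπ.isProbabilityMeasure
  rw [← hπ.1, ← hπ.2]
  exact cdfDistLE_map measurable_fst measurable_snd (by rwa [hπ.1]) hπr

lemma abs_integral_sub_integral_le_of_Winf_lt [IsProbabilityMeasure μ]
    (h : Winf μ ν < ENNReal.ofReal r) {K : Set ℝ} (hμ : ∀ᵐ x ∂μ, x ∈ K) (hν : ∀ᵐ y ∂ν, y ∈ K)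
    {f g : ℝ → ℝ} (hf : Integrable f μ) (hg : Integrable g ν) {δ : ℝ}
    (hfg : ∀ x ∈ K, ∀ y ∈ K, |x - y| ≤ r → |f x - g y| ≤ δ) :
    |∫ x, f x ∂μ - ∫ y, g y ∂ν| ≤ δ := by
  obtain ⟨π, hπ, hπr⟩ := exists_isPlan_of_Winf_lt h
  have := hπ.isProbabilityMeasure
  rw [← hπ.1] at hμ hf ⊢
  rw [← hπ.2] at hν hg ⊢
  have hf' : Integrable (fun p => f p.1) π := hf.comp_measurable measurable_fst
  have hg' : Integrable (fun p => g p.2) π := hg.comp_measurable measurable_snd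
  rw [integral_map measurable_fst.aemeasurable hf.1, integral_map measurable_snd.aemeasurable hg.1,
    ← integral_sub hf' hg']
  suffices h_ae : ∀ᵐ p ∂π, ‖f p.1 - g p.2‖ ≤ δ by
    simpa using norm_integral_le_of_norm_le_const h_ae
  filter_upwards [ae_of_ae_map measurable_fst.aemeasurable hμ,
    ae_of_ae_map measurable_snd.aemeasurable hν, hπr] with p hp₁ hp₂ hpr
  exact hfg _ hp₁ _ hp₂ hpr

end Winf

lemma integrable_of_continuous_of_ae_mem_Icc {μ : Measure ℝ} [IsFiniteMeasure μ] {A B : ℝ}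
    (hμ : ∀ᵐ x ∂μ, x ∈ Icc A B) {f : ℝ → ℝ} (hf : Continuous f) : Integrable f μ := by
  rw [← Measure.restrict_eq_self_of_ae_mem hμ]
  exact hf.continuousOn.integrableOn_compact isCompact_Icc

namespace IsContCurve

variable {T : ℝ} {ρ : ℝ → Measure ℝ}

lemma eventually_Winf_lt (h : IsContCurve T ρ) {s : ℝ} (hs : s ∈ Icc 0 T) {r : ℝ} (hr : 0 < r) :
    ∀ᶠ t in 𝓝[Icc 0 T] s, Winf (ρ s) (ρ t) < ENNReal.ofReal r :=
  (h.cont s hs).eventually_lt_const (ENNReal.ofReal_pos.2 hr)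

lemma exists_forall_ae_mem_Icc (h : IsContCurve T ρ) :
    ∃ R, ∀ t ∈ Icc 0 T, ∀ᵐ x ∂(ρ t), x ∈ Icc (-R) R := by
  have hmono : ∀ {μ : Measure ℝ} {R R' : ℝ}, R ≤ R' → (∀ᵐ x ∂μ, x ∈ Icc (-R) R) →
      ∀ᵐ x ∂μ, x ∈ Icc (-R') R' := fun hR hμ =>
    hμ.mono fun x hx => Icc_subset_Icc (neg_le_neg hR) hR hx
  refine isCompact_Icc.induction_on (p := fun s => ∃ R, ∀ t ∈ s, ∀ᵐ x ∂(ρ t), x ∈ Icc (-R) R)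
    ⟨0, by simp⟩ (fun s t hst ⟨R, hR⟩ => ⟨R, fun x hx => hR x (hst hx)⟩) ?_ fun s hs => ?_
  · rintro s t ⟨R, hR⟩ ⟨R', hR'⟩
    exact ⟨max R R', fun x hx => hx.elim (fun hx => hmono (le_max_left _ _) (hR x hx))
      fun hx => hmono (le_max_right _ _) (hR' x hx)⟩
  · obtain ⟨S, hS, hS0⟩ := (h.mem s hs).compact_supp
    obtain ⟨R, hR⟩ := hS.isBounded.subset_closedBall 0
    rw [Real.closedBall_eq_Icc, zero_sub, zero_add] at hR
    have hsupp : ∀ᵐ x ∂(ρ s), x ∈ Icc (-R) R := (measure_eq_zero_iff_ae_notMem.1 hS0).mono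
      fun x hx => hR (not_not.1 hx)
    exact ⟨_, h.eventually_Winf_lt hs one_pos, R + 1, fun t ht => ae_mem_Icc_of_Winf_lt ht hsupp⟩

lemma integrable (h : IsContCurve T ρ) {t : ℝ} (ht : t ∈ Icc 0 T) {f : ℝ → ℝ}
    (hf : Continuous f) : Integrable f (ρ t) :=
  have := (h.mem t ht).prob
  let ⟨_, hR⟩ := h.exists_forall_ae_mem_Icc
  integrable_of_continuous_of_ae_mem_Icc (hR t ht) hf

lemma continuousOn_integral {Y : Type*} [TopologicalSpace Y] (h : IsContCurve T ρ)
    {F : ℝ × Y → ℝ → ℝ} (hF : ContinuousOn (Function.uncurry F) ((Icc 0 T ×ˢ univ) ×ˢ univ)) :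
    ContinuousOn (fun p => ∫ x, F p x ∂(ρ p.1)) (Icc 0 T ×ˢ univ) := by
  obtain ⟨R, hR⟩ := h.exists_forall_ae_mem_Icc
  have hF_section : ∀ p ∈ Icc 0 T ×ˢ univ, Continuous (F p) := fun p hp =>
    hF.comp_continuous (.prodMk_right p) fun x => ⟨hp, mem_univ x⟩
  intro q hq
  have := (h.mem q.1 hq.1).prob
  refine Metric.tendsto_nhds.2 fun ε hε => ?_
  obtain ⟨δ, hδ, hFq⟩ := Metric.uniformContinuousOn_iff_le.1
    (isCompact_Icc.uniformContinuousOn_of_continuous (hF_section q hq).continuousOn)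
    (ε / 4) (by positivity)
  obtain ⟨N, hN, hFN⟩ := isCompact_Icc.mem_uniformity_of_prod
    (hF.mono (prod_mono_right (subset_univ (Icc (-R) R)))) hq
    (Metric.dist_mem_uniformity (show 0 < ε / 4 by positivity))
  have hW : ∀ᶠ p in 𝓝[Icc 0 T ×ˢ univ] q, Winf (ρ q.1) (ρ p.1) < ENNReal.ofReal δ :=
    (continuous_fst.continuousWithinAt.tendsto_nhdsWithin fun p hp => hp.1).eventually
      (h.eventually_Winf_lt hq.1 hδ)
  filter_upwards [hN, hW, self_mem_nhdsWithin] with p hpN hpW hp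
  rw [dist_comm]
  refine (abs_integral_sub_integral_le_of_Winf_lt hpW (hR _ hq.1) (hR _ hp.1)
    (h.integrable hq.1 (hF_section q hq)) (h.integrable hp.1 (hF_section p hp)) (δ := ε / 2)
    fun x hx y hy hxy => ?_).trans_lt (by linarith)
  have hspace : |F q x - F q y| ≤ ε / 4 := hFq x hx y hy hxy
  have hparam : |F p y - F q y| < ε / 4 := hFN p hpN y hy
  rw [abs_sub_comm] at hparam
  linarith [_root_.abs_sub_le (F q x) (F q y) (F p y)]

variable {V : Measure ℝ → ℝ → ℝ} {c C : ℝ≥0}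

lemma eventually_abs_field_sub_lt (hV : IsNonlocalField V c C) (h : IsContCurve T ρ) {s : ℝ}
    (hs : s ∈ Icc 0 T) {ε : ℝ} (hε : 0 < ε) :
    ∀ᶠ t in 𝓝[Icc 0 T] s, ∀ x, |V (ρ s) x - V (ρ t) x| < ε := by
  have := (h.mem s hs).prob
  set M := (linfNorm (ρ s)).toNNReal
  filter_upwards [h.eventually_Winf_lt hs (r := ε / (c * M + 1)) (by positivity),
    self_mem_nhdsWithin] with t hW ht x
  have := (h.mem t ht).prob
  calc _ ≤ c * (M * (ε / (c * M + 1))) :=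
        hV.lip (cdfDistLE_of_Winf_lt (h.mem s hs).densityLE hW) x
    _ = c * M / (c * M + 1) * ε := by ring
    _ < 1 * ε := by
        gcongr
        rw [div_lt_one (by positivity)]
        linarith
    _ = ε := one_mul ε

lemma continuousOn_field (hV : IsNonlocalField V c C) (h : IsContCurve T ρ) :
    ContinuousOn (fun p : ℝ × ℝ => V (ρ p.1) p.2) (Icc 0 T ×ˢ univ) := by
  intro q hq
  have := (h.mem q.1 hq.1).prob
  have hunif : TendstoUniformlyOn (fun p : ℝ × ℝ => V (ρ p.1)) (V (ρ q.1))
      (𝓝[Icc 0 T ×ˢ univ] q) univ := by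
    refine Metric.tendstoUniformlyOn_iff.2 fun ε hε => ?_
    filter_upwards [
      (continuous_fst.continuousWithinAt.tendsto_nhdsWithin fun p hp => hp.1).eventually
        (h.eventually_abs_field_sub_lt hV hq.1 hε)] with p hp x _
    exact hp x
  exact hunif.tendsto_comp
    (hV.lipschitzWith (h.mem q.1 hq.1).densityLE).continuous.continuousWithinAt
    (continuous_snd.continuousWithinAt.tendsto_nhdsWithin fun _ _ => mem_univ _)

end IsContCurve

/-! ### Weak derivatives in one variable -/

section WeakDeriv

variable {a b : ℝ}

lemma exists_contDiff_deriv_eq_of_integral_eq_zero {η : ℝ → ℝ}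
    (hη : ContDiff ℝ ((⊤ : ℕ∞) : WithTop ℕ∞) η) (hη_compact : HasCompactSupport η)
    (hη_supp : tsupport η ⊆ Ioo a b) (hη_int : ∫ t, η t = 0) :
    ∃ χ : ℝ → ℝ, ContDiff ℝ ((⊤ : ℕ∞) : WithTop ℕ∞) χ ∧ HasCompactSupport χ ∧
      tsupport χ ⊆ Ioo a b ∧ deriv χ = η := by
  rcases (tsupport η).eq_empty_or_nonempty with hempty | hne
  · obtain rfl : η = 0 := tsupport_eq_empty_iff.1 hempty
    exact ⟨0, contDiff_const, .zero, by simp [hempty], deriv_zero⟩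
  have hη_integrable : Integrable η := hη.continuous.integrable_of_hasCompactSupport hη_compact
  set χ : ℝ → ℝ := fun t => ∫ τ in Iic t, η τ
  have hχ_deriv : ∀ t, HasDerivAt χ (η t) t := fun t => by
    have hprim := intervalIntegral.integral_hasDerivAt_right
      (hη_integrable.intervalIntegrable (a := 0) (b := t))
      (hη.continuous.stronglyMeasurableAtFilter _ _) hη.continuous.continuousAt
    refine (hprim.add_const (χ 0)).congr_of_eventuallyEq (.of_forall fun s => ?_)
    exact eq_add_of_sub_eq (intervalIntegral.integral_Iic_sub_Iic hη_integrable.integrableOn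
      hη_integrable.integrableOn)
  obtain ⟨l, hl, hl_least⟩ := hη_compact.isCompact.exists_isLeast hne
  obtain ⟨u, hu, hu_greatest⟩ := hη_compact.isCompact.exists_isGreatest hne
  have hχ_zero : ∀ t ∉ Icc l u, χ t = 0 := fun t ht => by
    rcases lt_or_ge t l with htl | hlt
    · exact setIntegral_eq_zero_of_forall_eq_zero fun σ hσ =>
        image_eq_zero_of_notMem_tsupport fun hmem => (hσ.trans_lt htl).not_ge (hl_least hmem)
    · have hut : u < t := not_le.1 fun htu => ht ⟨hlt, htu⟩
      exact (setIntegral_eq_integral_of_forall_compl_eq_zero fun σ hσ =>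
        image_eq_zero_of_notMem_tsupport fun hmem =>
          (hut.trans (not_le.1 hσ)).not_ge (hu_greatest hmem)).trans hη_int
  have hχ_deriv_eq : deriv χ = η := funext fun t => (hχ_deriv t).deriv
  refine ⟨χ, ?_, .intro isCompact_Icc hχ_zero, ?_, hχ_deriv_eq⟩
  · rw [contDiff_infty_iff_deriv, hχ_deriv_eq]
    exact ⟨fun t => (hχ_deriv t).differentiableAt, hη⟩
  · refine (closure_minimal (Function.support_subset_iff'.2 hχ_zero) isClosed_Icc).trans
      (Icc_subset_Ioo (hη_supp hl).1 (hη_supp hu).2)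

lemma integrable_mul_of_hasCompactSupport {f g : ℝ → ℝ} (hf : Continuous f)
    (hf_compact : HasCompactSupport f) (hg : Continuous g) : Integrable fun t => f t * g t :=
  (hf.mul hg).integrable_of_hasCompactSupport hf_compact.mul_right

lemma exists_integral_mul_eq_of_integral_deriv_mul_eq_zero (hab : (Ioo a b).Nonempty)
    {g : ℝ → ℝ} (hg : Continuous g)
    (h : ∀ χ : ℝ → ℝ, ContDiff ℝ ((⊤ : ℕ∞) : WithTop ℕ∞) χ → HasCompactSupport χ →
      tsupport χ ⊆ Ioo a b → ∫ t, deriv χ t * g t = 0) :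
    ∃ C, ∀ χ : ℝ → ℝ, ContDiff ℝ ((⊤ : ℕ∞) : WithTop ℕ∞) χ → HasCompactSupport χ →
      tsupport χ ⊆ Ioo a b → ∫ t, χ t * g t = (∫ t, χ t) * C := by
  obtain ⟨m, hm⟩ := hab
  obtain ⟨r, hr, hball⟩ := Metric.nhds_basis_closedBall.mem_iff.1 (isOpen_Ioo.mem_nhds hm)
  let bump : ContDiffBump m := ⟨r / 2, r, by positivity, by linarith⟩
  set θ := bump.normed volume
  have hθ : ContDiff ℝ ((⊤ : ℕ∞) : WithTop ℕ∞) θ := bump.contDiff_normed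
  have hθ_compact : HasCompactSupport θ := bump.hasCompactSupport_normed
  have hθ_supp : tsupport θ ⊆ Ioo a b := bump.tsupport_normed_eq.trans_subset hball
  refine ⟨∫ t, θ t * g t, fun χ hχ hχ_compact hχ_supp => ?_⟩
  have hη_zero : ∫ t, (χ t - (∫ s, χ s) * θ t) = 0 := by
    rw [integral_sub (hχ.continuous.integrable_of_hasCompactSupport hχ_compact)
      (bump.integrable_normed.const_mul _), integral_const_mul, bump.integral_normed, mul_one,
      sub_self]
  obtain ⟨ζ, hζ, hζ_compact, hζ_supp, hζ_deriv⟩ := exists_contDiff_deriv_eq_of_integral_eq_zero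
    (hχ.sub (contDiff_const.mul hθ)) (hχ_compact.sub hθ_compact.mul_left)
    ((tsupport_sub _ _).trans (union_subset hχ_supp (tsupport_mul_subset_right.trans hθ_supp)))
    hη_zero
  have hζ_zero := h ζ hζ hζ_compact hζ_supp
  simp only [hζ_deriv, sub_mul, mul_assoc] at hζ_zero
  rwa [integral_sub (integrable_mul_of_hasCompactSupport hχ.continuous hχ_compact hg)
    ((integrable_mul_of_hasCompactSupport hθ.continuous hθ_compact hg).const_mul _),
    integral_const_mul, sub_eq_zero] at hζ_zero

lemma exists_eqOn_const_of_integral_deriv_mul_eq_zero {g : ℝ → ℝ} (hg : Continuous g)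
    (h : ∀ χ : ℝ → ℝ, ContDiff ℝ ((⊤ : ℕ∞) : WithTop ℕ∞) χ → HasCompactSupport χ →
      tsupport χ ⊆ Ioo a b → ∫ t, deriv χ t * g t = 0) :
    ∃ C, EqOn g (fun _ => C) (Ioo a b) := by
  rcases (Ioo a b).eq_empty_or_nonempty with hempty | hab
  · exact ⟨0, by simp [hempty]⟩
  obtain ⟨C, hC⟩ := exists_integral_mul_eq_of_integral_deriv_mul_eq_zero hab hg h
  have hsub : Continuous fun t => g t - C := hg.sub continuous_const
  have hae : ∀ᵐ t, t ∈ Ioo a b → g t - C = 0 :=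
    isOpen_Ioo.ae_eq_zero_of_integral_contDiff_smul_eq_zero
      (hsub.locallyIntegrable.locallyIntegrableOn _) fun χ hχ hχ_compact hχ_supp => by
        simp only [smul_eq_mul, mul_sub]
        rw [integral_sub (integrable_mul_of_hasCompactSupport hχ.continuous hχ_compact hg)
          (integrable_mul_of_hasCompactSupport hχ.continuous hχ_compact continuous_const),
          integral_mul_const, hC χ hχ hχ_compact hχ_supp, sub_self]
  have heq := Measure.eqOn_open_of_ae_eq ((ae_restrict_iff' measurableSet_Ioo).2 hae) isOpen_Ioo
    hsub.continuousOn continuousOn_const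
  exact ⟨C, fun t ht => sub_eq_zero.1 (heq ht)⟩

lemma hasDerivAt_of_integral_eq_zero {g k : ℝ → ℝ} (hg : Continuous g) (hk : Continuous k)
    (h : ∀ χ : ℝ → ℝ, ContDiff ℝ ((⊤ : ℕ∞) : WithTop ℕ∞) χ → HasCompactSupport χ →
      tsupport χ ⊆ Ioo a b → ∫ t, (deriv χ t * g t + χ t * k t) = 0) {s : ℝ}
    (hs : s ∈ Ioo a b) : HasDerivAt g (k s) s := by
  set J : ℝ → ℝ := fun t => ∫ τ in (0 : ℝ)..t, k τ
  have hJ : ∀ t, HasDerivAt J (k t) t := fun t =>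
    (hk.integral_hasStrictDerivAt 0 t).hasDerivAt
  have hJ_cont : Continuous J := continuous_iff_continuousAt.2 fun t => (hJ t).continuousAt
  obtain ⟨C, hC⟩ := exists_eqOn_const_of_integral_deriv_mul_eq_zero (hg.sub hJ_cont)
    fun χ hχ hχ_compact hχ_supp => by
      have hχ' : Continuous (deriv χ) := hχ.continuous_deriv (by simp)
      have hparts : ∫ t, χ t * k t = -∫ t, deriv χ t * J t :=
        integral_mul_deriv_eq_deriv_mul_of_integrable
          (fun t _ => (hχ.differentiable (by simp) t).hasDerivAt) (fun t _ => hJ t)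
          (integrable_mul_of_hasCompactSupport hχ.continuous hχ_compact hk)
          (integrable_mul_of_hasCompactSupport hχ' hχ_compact.deriv hJ_cont)
          (integrable_mul_of_hasCompactSupport hχ.continuous hχ_compact hJ_cont)
      have hweak := h χ hχ hχ_compact hχ_supp
      rw [integral_add (integrable_mul_of_hasCompactSupport hχ' hχ_compact.deriv hg)
        (integrable_mul_of_hasCompactSupport hχ.continuous hχ_compact hk), hparts] at hweak
      simp only [Pi.sub_apply, mul_sub]
      rw [integral_sub (integrable_mul_of_hasCompactSupport hχ' hχ_compact.deriv hg)
        (integrable_mul_of_hasCompactSupport hχ' hχ_compact.deriv hJ_cont)]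
      linarith
  refine ((hJ s).add_const C).congr_of_eventuallyEq ?_
  filter_upwards [isOpen_Ioo.mem_nhds hs] with t ht
  exact sub_eq_iff_eq_add'.1 (hC ht)

lemma hasDerivAt_of_intervalIntegral_eq_zero {g k : ℝ → ℝ} (hg : ContinuousOn g (Icc a b))
    (hk : ContinuousOn k (Icc a b))
    (h : ∀ χ : ℝ → ℝ, ContDiff ℝ ((⊤ : ℕ∞) : WithTop ℕ∞) χ → HasCompactSupport χ →
      tsupport χ ⊆ Ioo a b → ∫ t in a..b, (deriv χ t * g t + χ t * k t) = 0) {s : ℝ}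
    (hs : s ∈ Ioo a b) : HasDerivAt g (k s) s := by
  have hab : a ≤ b := (hs.1.trans hs.2).le
  have extend_eq : ∀ f : ℝ → ℝ, ∀ t ∈ Icc a b, IccExtend hab (domRestrict _ f) t = f t :=
    fun f t ht => IccExtend_of_mem hab _ ht
  have hderiv := hasDerivAt_of_integral_eq_zero (g := IccExtend hab (domRestrict _ g))
    (k := IccExtend hab (domRestrict _ k)) hg.domRestrict.Icc_extend' hk.domRestrict.Icc_extend'
    (fun χ hχ hχ_compact hχ_supp => ?_) hs
  · rw [extend_eq k s (Ioo_subset_Icc_self hs)] at hderiv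
    refine hderiv.congr_of_eventuallyEq ?_
    filter_upwards [Icc_mem_nhds hs.1 hs.2] with t ht
    exact (extend_eq g t ht).symm
  · rw [← intervalIntegral.integral_eq_integral_of_support_subset (a := a) (b := b),
      ← h χ hχ hχ_compact hχ_supp]
    · refine intervalIntegral.integral_congr fun t ht => ?_
      rw [uIcc_of_le hab] at ht
      simp only [extend_eq _ t ht]
    · refine Function.support_subset_iff'.2 fun t ht => ?_
      have htχ : t ∉ tsupport χ := fun hmem => ht (Ioo_subset_Ioc_self (hχ_supp hmem))
      rw [image_eq_zero_of_notMem_tsupport htχ, image_eq_zero_of_notMem_tsupport fun hmem =>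
        htχ (tsupport_deriv_subset (f := χ) hmem)]
      simp

end WeakDeriv

/-! ### Averages of a weak solution over moving windows -/

lemma isTestFun_mul {T : ℝ} {χ ψ : ℝ → ℝ} (hχ : ContDiff ℝ ((⊤ : ℕ∞) : WithTop ℕ∞) χ)
    (hχ_compact : HasCompactSupport χ) (hχ_supp : tsupport χ ⊆ Ioo 0 T)
    (hψ : ContDiff ℝ ((⊤ : ℕ∞) : WithTop ℕ∞) ψ) (hψ_compact : HasCompactSupport ψ) :
    IsTestFun T fun p => χ p.1 * ψ p.2 := by
  have hsub : Function.support (fun p : ℝ × ℝ => χ p.1 * ψ p.2) ⊆ tsupport χ ×ˢ tsupport ψ :=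
    fun p hp => ⟨subset_tsupport _ (left_ne_zero_of_mul hp),
      subset_tsupport _ (right_ne_zero_of_mul hp)⟩
  exact ⟨(hχ.comp contDiff_fst).mul (hψ.comp contDiff_snd),
    .of_support_subset_isCompact (hχ_compact.isCompact.prod hψ_compact.isCompact) hsub,
    (closure_minimal hsub ((isClosed_tsupport _).prod (isClosed_tsupport _))).trans
      (prod_mono hχ_supp (subset_univ _))⟩

lemma hasDerivAt_integral_comp_sub {μ : Measure ℝ} [IsFiniteMeasure μ] {A B : ℝ}
    (hμ : ∀ᵐ x ∂μ, x ∈ Icc A B) {ψ : ℝ → ℝ} (hψ : ContDiff ℝ 1 ψ) (y : ℝ) :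
    HasDerivAt (fun y => ∫ x, ψ (x - y) ∂μ) (∫ x, -deriv ψ (x - y) ∂μ) y := by
  have hψ' : Continuous (deriv ψ) := hψ.continuous_deriv le_rfl
  have hshift : ∀ {f : ℝ → ℝ}, Continuous f → ∀ y, Continuous fun x => f (x - y) := fun hf y =>
    hf.comp (continuous_sub_right y)
  obtain ⟨D, hD⟩ := isCompact_Icc.exists_bound_of_continuousOn
    (hψ'.continuousOn (s := Icc (A - (y + 1)) (B - (y - 1))))
  refine (hasDerivAt_integral_of_dominated_loc_of_deriv_le (bound := fun _ => D)
    (Icc_mem_nhds (sub_one_lt y) (lt_add_one y))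
    (.of_forall fun y => (hshift hψ.continuous y).aestronglyMeasurable)
    (integrable_of_continuous_of_ae_mem_Icc hμ (hshift hψ.continuous y))
    (F' := fun y x => -deriv ψ (x - y)) (hshift hψ' y).neg.aestronglyMeasurable ?_
    (integrable_const _) (ae_of_all _ fun x u _ => ?_)).2
  · filter_upwards [hμ] with x hx u hu
    rw [norm_neg]
    exact hD _ ⟨by linarith [hx.1, hu.2], by linarith [hx.2, hu.1]⟩
  · simpa using ((hψ.differentiable one_ne_zero (x - u)).hasDerivAt.comp_const_sub x u)

lemma hasDerivAt_of_hasDerivAt_partial {F A B : ℝ → ℝ → ℝ} {z : ℝ → ℝ} {z' s : ℝ}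
    (hA : ∀ᶠ p : ℝ × ℝ in 𝓝 (s, z s), HasDerivAt (fun t => F t p.2) (A p.1 p.2) p.1)
    (hB : ∀ᶠ p : ℝ × ℝ in 𝓝 (s, z s), HasDerivAt (fun y => F p.1 y) (B p.1 p.2) p.2)
    (hA_cont : ContinuousAt (fun p : ℝ × ℝ => A p.1 p.2) (s, z s))
    (hB_cont : ContinuousAt (fun p : ℝ × ℝ => B p.1 p.2) (s, z s)) (hz : HasDerivAt z z' s) :
    HasDerivAt (fun t => F t (z t)) (A s (z s) + B s (z s) * z') s := by
  have hstrict := hasStrictFDerivAt_uncurry_coprod (𝕜 := ℝ) (u := (s, z s)) (f := F)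
    (f₁ := fun t y => A t y • (1 : ℝ →L[ℝ] ℝ)) (f₂ := fun t y => B t y • (1 : ℝ →L[ℝ] ℝ))
    (hA.mono fun p hp => hp.hasFDerivAt.congr_fderiv (by ext; simp [Function.HasUncurry.uncurry]))
    (hB.mono fun p hp => hp.hasFDerivAt.congr_fderiv (by ext; simp [Function.HasUncurry.uncurry]))
    (hA_cont.smul continuousAt_const) (hB_cont.smul continuousAt_const)
  refine (hstrict.hasFDerivAt.comp_hasDerivAt (f := fun t => (t, z t)) s
    ((hasDerivAt_id s).prodMk hz)).congr_deriv ?_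
  simp [Function.HasUncurry.uncurry]

namespace IsContCurve

variable {V : Measure ℝ → ℝ → ℝ} {c C : ℝ≥0} {T : ℝ} {ρ : ℝ → Measure ℝ} {ψ : ℝ → ℝ}

lemma continuousOn_integral_comp_sub (h : IsContCurve T ρ) (hψ : Continuous ψ) :
    ContinuousOn (fun p : ℝ × ℝ => ∫ x, ψ (x - p.2) ∂(ρ p.1)) (Icc 0 T ×ˢ univ) :=
  h.continuousOn_integral (F := fun p x => ψ (x - p.2))
    (hψ.comp (continuous_snd.sub (continuous_snd.comp continuous_fst))).continuousOn

lemma continuousOn_integral_field_mul_comp_sub (hV : IsNonlocalField V c C)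
    (h : IsContCurve T ρ) (hψ : Continuous ψ) :
    ContinuousOn (fun p : ℝ × ℝ => ∫ x, V (ρ p.1) x * ψ (x - p.2) ∂(ρ p.1))
      (Icc 0 T ×ˢ univ) :=
  h.continuousOn_integral (F := fun p x => V (ρ p.1) x * ψ (x - p.2))
    (((h.continuousOn_field hV).comp (f := fun q : (ℝ × ℝ) × ℝ => (q.1.1, q.2)) (by fun_prop)
      fun q hq => ⟨hq.1.1, mem_univ _⟩).mul
      (hψ.comp (continuous_snd.sub (continuous_snd.comp continuous_fst))).continuousOn)

lemma continuous_field (hV : IsNonlocalField V c C) (h : IsContCurve T ρ) {t : ℝ}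
    (ht : t ∈ Icc 0 T) : Continuous (V (ρ t)) :=
  have := (h.mem t ht).prob
  (hV.lipschitzWith (h.mem t ht).densityLE).continuous

end IsContCurve

namespace IsWeakSolution

variable {v w ψ z : ℝ → ℝ} {c C : ℝ≥0} {T s : ℝ} {ρ₀ : Measure ℝ} {ρ : ℝ → Measure ℝ}

lemma hasDerivAt_integral_of_hasCompactSupport (hV : IsNonlocalField (velocity v w) c C)
    (hρ : IsWeakSolution v w ρ₀ T ρ) (hψ : ContDiff ℝ ((⊤ : ℕ∞) : WithTop ℕ∞) ψ)
    (hψ_compact : HasCompactSupport ψ) (hs : s ∈ Ioo 0 T) :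
    HasDerivAt (fun t => ∫ x, ψ x ∂(ρ t)) (∫ x, velocity v w (ρ s) x * deriv ψ x ∂(ρ s)) s := by
  have hψ' : Continuous (deriv ψ) := hψ.continuous_deriv (by simp)
  have section_zero : ∀ {G : ℝ × ℝ → ℝ}, ContinuousOn G (Icc 0 T ×ˢ univ) →
      ContinuousOn (fun t => G (t, 0)) (Icc 0 T) := fun hG =>
    hG.comp (Continuous.prodMk_left 0).continuousOn fun t ht => ⟨ht, mem_univ _⟩
  have hmass := section_zero (hρ.curve.continuousOn_integral_comp_sub hψ.continuous)
  have hflux := section_zero (hρ.curve.continuousOn_integral_field_mul_comp_sub hV hψ')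
  simp only [sub_zero] at hmass hflux
  refine hasDerivAt_of_intervalIntegral_eq_zero hmass hflux
    (fun χ hχ hχ_compact hχ_supp => ?_) hs
  refine Eq.trans ?_ (hρ.weak _ (isTestFun_mul hχ hχ_compact hχ_supp hψ hψ_compact))
  refine intervalIntegral.integral_congr fun t ht => ?_
  rw [uIcc_of_le (hs.1.trans hs.2).le] at ht
  have hflux_int : Integrable (fun x => velocity v w (ρ t) x * deriv ψ x) (ρ t) :=
    hρ.curve.integrable ht ((hρ.curve.continuous_field hV ht).mul hψ')
  simp only
  rw [← integral_const_mul, ← integral_const_mul, ← integral_add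
    ((hρ.curve.integrable ht hψ.continuous).const_mul _) (hflux_int.const_mul _)]
  refine integral_congr_ae (ae_of_all _ fun x => ?_)
  simp only
  rw [deriv_mul_const (hχ.differentiable (by simp) t),
    deriv_const_mul _ (hψ.differentiable (by simp) x), mul_left_comm]

lemma hasDerivAt_integral (hV : IsNonlocalField (velocity v w) c C)
    (hρ : IsWeakSolution v w ρ₀ T ρ) (hψ : ContDiff ℝ ((⊤ : ℕ∞) : WithTop ℕ∞) ψ)
    (hs : s ∈ Ioo 0 T) :
    HasDerivAt (fun t => ∫ x, ψ x ∂(ρ t)) (∫ x, velocity v w (ρ s) x * deriv ψ x ∂(ρ s)) s := by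
  obtain ⟨R, hR⟩ := hρ.curve.exists_forall_ae_mem_Icc
  let bump : ContDiffBump (0 : ℝ) := ⟨|R| + 1, |R| + 2, by positivity, by linarith⟩
  have bump_mul_eq : ∀ x ∈ Icc (-R) R, (fun y => bump y * ψ y) =ᶠ[𝓝 x] ψ := fun x hx => by
    have hx_ball : x ∈ Metric.ball 0 bump.rIn := by
      rw [mem_ball_zero_iff]
      exact (abs_le.2 hx).trans_lt ((le_abs_self R).trans_lt (lt_add_one _))
    filter_upwards [bump.eventuallyEq_one_of_mem_ball hx_ball] with y hy
    rw [hy, Pi.one_apply, one_mul]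
  refine ((hρ.hasDerivAt_integral_of_hasCompactSupport hV (bump.contDiff.mul hψ)
    bump.hasCompactSupport.mul_right hs).congr_of_eventuallyEq ?_).congr_deriv ?_
  · filter_upwards [Icc_mem_nhds hs.1 hs.2] with t ht
    exact integral_congr_ae ((hR t ht).mono fun x hx => (bump_mul_eq x hx).self_of_nhds.symm)
  · refine integral_congr_ae ((hR s (Ioo_subset_Icc_self hs)).mono fun x hx => ?_)
    simp only
    rw [(bump_mul_eq x hx).deriv_eq]

lemma hasDerivAt_integral_comp_sub (hV : IsNonlocalField (velocity v w) c C)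
    (hρ : IsWeakSolution v w ρ₀ T ρ) (hψ : ContDiff ℝ ((⊤ : ℕ∞) : WithTop ℕ∞) ψ)
    (hs : s ∈ Ioo 0 T) {z' : ℝ} (hz : HasDerivAt z z' s) :
    HasDerivAt (fun t => ∫ x, ψ (x - z t) ∂(ρ t))
      (∫ x, (velocity v w (ρ s) x - z') * deriv ψ (x - z s) ∂(ρ s)) s := by
  have hψ' : Continuous (deriv ψ) := hψ.continuous_deriv (by simp)
  obtain ⟨R, hR⟩ := hρ.curve.exists_forall_ae_mem_Icc
  have hnhds : (Icc 0 T ×ˢ univ : Set (ℝ × ℝ)) ∈ 𝓝 (s, z s) :=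
    prod_mem_nhds (Icc_mem_nhds hs.1 hs.2) univ_mem
  have hIoo : ∀ᶠ p : ℝ × ℝ in 𝓝 (s, z s), p.1 ∈ Ioo 0 T :=
    continuous_fst.continuousAt.eventually (Ioo_mem_nhds hs.1 hs.2)
  refine (hasDerivAt_of_hasDerivAt_partial (F := fun t y => ∫ x, ψ (x - y) ∂(ρ t))
    (A := fun t y => ∫ x, velocity v w (ρ t) x * deriv ψ (x - y) ∂(ρ t))
    (B := fun t y => ∫ x, -deriv ψ (x - y) ∂(ρ t)) ?_ ?_
    ((hρ.curve.continuousOn_integral_field_mul_comp_sub hV hψ').continuousAt hnhds)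
    ((hρ.curve.continuousOn_integral_comp_sub hψ'.neg).continuousAt hnhds) hz).congr_deriv ?_
  · filter_upwards [hIoo] with p hp
    have htime := hρ.hasDerivAt_integral hV
      (hψ.comp ((contDiff_id (E := ℝ)).sub (contDiff_const (c := p.2)))) hp
    simpa [Function.comp_def, deriv_comp_sub_const] using htime
  · filter_upwards [hIoo] with p hp
    have hp_Icc := Ioo_subset_Icc_self hp
    have := (hρ.curve.mem p.1 hp_Icc).prob
    exact NonlocalTransport.hasDerivAt_integral_comp_sub (hR p.1 hp_Icc) (hψ.of_le (by simp)) p.2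
  · have hs_Icc := Ioo_subset_Icc_self hs
    have hshift : Continuous fun x => deriv ψ (x - z s) := hψ'.comp (continuous_sub_right (z s))
    simp only [sub_mul, integral_neg]
    have hflux : Integrable (fun x => velocity v w (ρ s) x * deriv ψ (x - z s)) (ρ s) :=
      hρ.curve.integrable hs_Icc ((hρ.curve.continuous_field hV hs_Icc).mul hshift)
    rw [integral_sub hflux ((hρ.curve.integrable hs_Icc hshift).const_mul z'), integral_const_mul]
    ring

end IsWeakSolution

/-! ### Fronts -/

/-- A smooth decreasing step of width `ε`, equal to `1` on `(-∞, 0]` and to `0` on `[ε, ∞)`: an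
approximation of the indicator of a half-line. -/
noncomputable def smoothStep (ε u : ℝ) : ℝ :=
  Real.smoothTransition (1 - u / ε)

section SmoothStep

variable {ε u : ℝ}

lemma contDiff_smoothStep : ContDiff ℝ ((⊤ : ℕ∞) : WithTop ℕ∞) (smoothStep ε) :=
  Real.smoothTransition.contDiff.comp (contDiff_const.sub (contDiff_id.div_const ε))

lemma antitone_smoothStep (hε : 0 < ε) : Antitone (smoothStep ε) := fun u u' h =>
  Real.smoothTransition.monotone (by gcongr)

lemma smoothStep_of_nonpos (hε : 0 < ε) (hu : u ≤ 0) : smoothStep ε u = 1 :=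
  Real.smoothTransition.one_of_one_le (by linarith [div_nonpos_of_nonpos_of_nonneg hu hε.le])

lemma smoothStep_of_le (hε : 0 < ε) (hu : ε ≤ u) : smoothStep ε u = 0 :=
  Real.smoothTransition.zero_of_nonpos (by linarith [(one_le_div hε).2 hu])

lemma deriv_smoothStep_of_notMem_Icc (hε : 0 < ε) (hu : u ∉ Icc 0 ε) :
    deriv (smoothStep ε) u = 0 := by
  rcases not_and_or.1 hu with hu | hu
  · have : smoothStep ε =ᶠ[𝓝 u] fun _ => 1 :=
      (gt_mem_nhds (not_le.1 hu)).mono fun y hy => smoothStep_of_nonpos hε hy.le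
    rw [this.deriv_eq, deriv_const]
  · have : smoothStep ε =ᶠ[𝓝 u] fun _ => 0 :=
      (lt_mem_nhds (not_le.1 hu)).mono fun y hy => smoothStep_of_le hε hy.le
    rw [this.deriv_eq, deriv_const]

lemma tendsto_integral_smoothStep (μ : Measure ℝ) [IsFiniteMeasure μ] (z : ℝ) :
    Tendsto (fun ε => ∫ x, smoothStep ε (x - z) ∂μ) (𝓝[>] 0) (𝓝 (μ.real (Iic z))) := by
  rw [← integral_indicator_one measurableSet_Iic]
  refine tendsto_integral_filter_of_dominated_convergence (fun _ => 1)
    (.of_forall fun ε =>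
      (contDiff_smoothStep.continuous.comp (continuous_sub_right z)).aestronglyMeasurable)
    (.of_forall fun ε => ae_of_all _ fun x => ?_) (integrable_const 1) (ae_of_all _ fun x => ?_)
  · rw [Real.norm_eq_abs, smoothStep, abs_of_nonneg (Real.smoothTransition.nonneg _)]
    exact Real.smoothTransition.le_one _
  · refine tendsto_const_nhds.congr' ?_
    rcases le_or_gt x z with hx | hx
    · filter_upwards [self_mem_nhdsWithin] with ε hε
      rw [indicator_of_mem (mem_Iic.2 hx), smoothStep_of_nonpos hε (sub_nonpos.2 hx), Pi.one_apply]
    · filter_upwards [Ioc_mem_nhdsGT (sub_pos.2 hx)] with ε hε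
      rw [indicator_of_notMem (notMem_Iic.2 hx), smoothStep_of_le hε.1 hε.2]

end SmoothStep

namespace IsWeakSolution

variable {v w z z' : ℝ → ℝ} {c C : ℝ≥0} {T ε t : ℝ} {ρ₀ : Measure ℝ} {ρ : ℝ → Measure ℝ}
  (hV : IsNonlocalField (velocity v w) c C) (hρ : IsWeakSolution v w ρ₀ T ρ)
  (hz : ContinuousOn z (Icc 0 T)) (hz' : ∀ s ∈ Ioo 0 T, HasDerivAt z (z' s) s) (hε : 0 < ε)

include hV hρ hz hz' hε

lemma monotoneOn_integral_smoothStep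
    (hvel : ∀ s ∈ Ioo 0 T, ∀ x ∈ Icc (z s) (z s + ε), velocity v w (ρ s) x ≤ z' s) :
    MonotoneOn (fun t => ∫ x, smoothStep ε (x - z t) ∂(ρ t)) (Icc 0 T) := by
  refine monotoneOn_of_hasDerivWithinAt_nonneg (convex_Icc 0 T)
    (f' := fun s => ∫ x, (velocity v w (ρ s) x - z' s) * deriv (smoothStep ε) (x - z s) ∂(ρ s))
    ((hρ.curve.continuousOn_integral_comp_sub contDiff_smoothStep.continuous).comp
      (continuousOn_id.prodMk hz) fun s hs => ⟨hs, mem_univ _⟩)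
    (fun s hs => ?_) (fun s hs => ?_) <;> rw [interior_Icc] at hs
  · exact (hρ.hasDerivAt_integral_comp_sub hV contDiff_smoothStep hs (hz' s hs)).hasDerivWithinAt
  · refine integral_nonneg fun x => ?_
    by_cases hx : x - z s ∈ Icc 0 ε
    · rw [sub_mem_Icc_iff_left, zero_add, add_comm] at hx
      exact mul_nonneg_of_nonpos_of_nonpos (sub_nonpos.2 (hvel s hs x hx))
        (antitone_smoothStep hε).deriv_nonpos
    · simp [deriv_smoothStep_of_notMem_Icc hε hx]

lemma antitoneOn_integral_smoothStep
    (hvel : ∀ s ∈ Ioo 0 T, ∀ x ∈ Icc (z s) (z s + ε), z' s ≤ velocity v w (ρ s) x) :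
    AntitoneOn (fun t => ∫ x, smoothStep ε (x - z t) ∂(ρ t)) (Icc 0 T) := by
  refine antitoneOn_of_hasDerivWithinAt_nonpos (convex_Icc 0 T)
    (f' := fun s => ∫ x, (velocity v w (ρ s) x - z' s) * deriv (smoothStep ε) (x - z s) ∂(ρ s))
    ((hρ.curve.continuousOn_integral_comp_sub contDiff_smoothStep.continuous).comp
      (continuousOn_id.prodMk hz) fun s hs => ⟨hs, mem_univ _⟩)
    (fun s hs => ?_) (fun s hs => ?_) <;> rw [interior_Icc] at hs
  · exact (hρ.hasDerivAt_integral_comp_sub hV contDiff_smoothStep hs (hz' s hs)).hasDerivWithinAt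
  · refine integral_nonpos fun x => ?_
    by_cases hx : x - z s ∈ Icc 0 ε
    · rw [sub_mem_Icc_iff_left, zero_add, add_comm] at hx
      exact mul_nonpos_of_nonneg_of_nonpos (sub_nonneg.2 (hvel s hs x hx))
        (antitone_smoothStep hε).deriv_nonpos
    · simp [deriv_smoothStep_of_notMem_Icc hε hx]

lemma measureReal_Iic_le_of_velocity_le
    (hvel : ∀ s ∈ Ioo 0 T, ∀ x ∈ Icc (z s) (z s + ε), velocity v w (ρ s) x ≤ z' s)
    (ht : t ∈ Icc 0 T) : (ρ 0).real (Iic (z 0)) ≤ (ρ t).real (Iic (z t)) := by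
  have h0 : (0 : ℝ) ∈ Icc 0 T := left_mem_Icc.2 (ht.1.trans ht.2)
  have := (hρ.curve.mem 0 h0).prob
  have := (hρ.curve.mem t ht).prob
  refine le_of_tendsto_of_tendsto (tendsto_integral_smoothStep (ρ 0) (z 0))
    (tendsto_integral_smoothStep (ρ t) (z t)) ?_
  filter_upwards [Ioc_mem_nhdsGT hε] with δ hδ
  exact hρ.monotoneOn_integral_smoothStep hV hz hz' hδ.1
    (fun s hs x hx => hvel s hs x ⟨hx.1, hx.2.trans (by gcongr; exact hδ.2)⟩) h0 ht ht.1

lemma measureReal_Iic_le_of_le_velocity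
    (hvel : ∀ s ∈ Ioo 0 T, ∀ x ∈ Icc (z s) (z s + ε), z' s ≤ velocity v w (ρ s) x)
    (ht : t ∈ Icc 0 T) : (ρ t).real (Iic (z t)) ≤ (ρ 0).real (Iic (z 0)) := by
  have h0 : (0 : ℝ) ∈ Icc 0 T := left_mem_Icc.2 (ht.1.trans ht.2)
  have := (hρ.curve.mem 0 h0).prob
  have := (hρ.curve.mem t ht).prob
  refine le_of_tendsto_of_tendsto (tendsto_integral_smoothStep (ρ t) (z t))
    (tendsto_integral_smoothStep (ρ 0) (z 0)) ?_
  filter_upwards [Ioc_mem_nhdsGT hε] with δ hδ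
  exact hρ.antitoneOn_integral_smoothStep hV hz hz' hδ.1
    (fun s hs x hx => hvel s hs x ⟨hx.1, hx.2.trans (by gcongr; exact hδ.2)⟩) h0 ht ht.1

end IsWeakSolution

/-! ### Uniqueness -/

namespace IsLagrangianSolution

variable {κ C : ℝ≥0} {T t : ℝ} {X : ℝ → ℝ → ℝ} {ρ₀ : Measure ℝ}

lemma surjective {V : Measure ℝ → ℝ → ℝ} (hX : IsLagrangianSolution V ρ₀ κ C T X) (t : ℝ) :
    Function.Surjective (X t) := fun y => by
  have hdisp : ∀ x, |X t x - x| ≤ C * |t| := fun x => by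
    simpa [hX.zero, Real.dist_eq] using (hX.lipschitzWith x).dist_le_mul t 0
  refine mem_range_of_exists_le_of_exists_ge (hX.isMonoBiLipschitz t).lipschitz.continuous
    ⟨y - C * |t|, ?_⟩ ⟨y + C * |t|, ?_⟩
  · linarith [(abs_le.1 (hdisp (y - C * |t|))).2]
  · linarith [(abs_le.1 (hdisp (y + C * |t|))).1]

variable {v w : ℝ → ℝ} {c a : ℝ≥0} {ρ : ℝ → Measure ℝ} [IsProbabilityMeasure ρ₀]
  (hX : IsLagrangianSolution (velocity v w) ρ₀ κ C T X)
  (hV : IsNonlocalField (velocity v w) c C) (ha : DensityLE a ρ₀)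
  (hρ : IsWeakSolution v w ρ₀ T ρ)

include hX hV ha hρ

section Barrier

variable {D r r' : ℝ → ℝ} {ε : ℝ} (hD : ∀ s ∈ Icc 0 T, CdfDistLE (D s) (ρ₀.map (X s)) (ρ s))
  (hr0 : ∀ s ∈ Icc 0 T, 0 ≤ r s) (hr_cont : ContinuousOn r (Icc 0 T))
  (hr : ∀ s ∈ Ioo 0 T, HasDerivAt r (r' s) s) (hε : 0 < ε)
  (hr' : ∀ s ∈ Ioo 0 T, c * (a * κ * (r s + ε) + D s) ≤ r' s) (ht : t ∈ Icc 0 T)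

include hD hr' in
lemma abs_velocity_sub_le {s x y : ℝ} (hs : s ∈ Ioo 0 T) (hxy : |X s x - y| ≤ r s + ε) :
    |velocity v w (ρ₀.map (X s)) (X s x) - velocity v w (ρ s) y| ≤ r' s := by
  have hbi := hX.isMonoBiLipschitz s
  have hs' := Ioo_subset_Icc_self hs
  have := hbi.isProbabilityMeasure_map ρ₀
  have := (hρ.curve.mem s hs').prob
  refine (hV.abs_sub_le_of_cdfDistLE (hbi.densityLE_map ha) (hD s hs') (X s x) y).trans
    (le_trans ?_ (hr' s hs))
  rw [NNReal.coe_mul]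
  gcongr

include hD hr0 hr_cont hr hε hr' ht

lemma measureReal_Iic_le_add (y : ℝ) :
    (ρ₀.map (X t)).real (Iic y) ≤ (ρ t).real (Iic (y + r t)) := by
  obtain ⟨x, rfl⟩ := hX.surjective t y
  have hfront := hρ.measureReal_Iic_le_of_velocity_le hV (z := fun s => X s x + r s)
    (((hX.lipschitzWith x).continuous.continuousOn).add hr_cont)
    (fun s hs => (hX.hasDerivAt s hs x).add (hr s hs)) hε (fun s hs y hy => ?_) ht
  · rw [(hX.isMonoBiLipschitz t).measureReal_map_Iic]
    refine le_trans ?_ hfront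
    rw [hρ.init, hX.zero]
    exact measureReal_mono
      (Iic_subset_Iic.2 (le_add_of_nonneg_right (hr0 0 ⟨le_rfl, ht.1.trans ht.2⟩)))
  · have hwindow := hX.abs_velocity_sub_le hV ha hρ hD hr' (x := x) (y := y) hs (by
      rw [abs_le]; constructor <;> linarith [hy.1, hy.2, hr0 s (Ioo_subset_Icc_self hs)])
    linarith [(abs_le.1 hwindow).1]

lemma measureReal_Iic_sub_le (y : ℝ) :
    (ρ t).real (Iic (y - r t)) ≤ (ρ₀.map (X t)).real (Iic y) := by
  obtain ⟨x, rfl⟩ := hX.surjective t y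
  have hfront := hρ.measureReal_Iic_le_of_le_velocity hV (z := fun s => X s x - r s)
    (((hX.lipschitzWith x).continuous.continuousOn).sub hr_cont)
    (fun s hs => (hX.hasDerivAt s hs x).sub (hr s hs)) hε (fun s hs y hy => ?_) ht
  · rw [(hX.isMonoBiLipschitz t).measureReal_map_Iic]
    refine hfront.trans ?_
    rw [hρ.init, hX.zero]
    exact measureReal_mono (Iic_subset_Iic.2 (sub_le_self _ (hr0 0 ⟨le_rfl, ht.1.trans ht.2⟩)))
  · have hwindow := hX.abs_velocity_sub_le hV ha hρ hD hr' (x := x) (y := y) hs (by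
      rw [abs_le]; constructor <;> linarith [hy.1, hy.2, hr0 s (Ioo_subset_Icc_self hs)])
    linarith [(abs_le.1 hwindow).2]

lemma cdfDistLE_mul : CdfDistLE (a * κ * r t) (ρ₀.map (X t)) (ρ t) := fun y => by
  have := (hX.isMonoBiLipschitz t).isProbabilityMeasure_map ρ₀
  have hlip : ∀ y z, |(ρ₀.map (X t)).real (Iic y) - (ρ₀.map (X t)).real (Iic z)| ≤
      a * κ * |y - z| :=
    ((hX.isMonoBiLipschitz t).densityLE_map ha).lipschitzWith_measureReal_Iic.dist_le_mul
  have upper := hX.measureReal_Iic_sub_le hV ha hρ hD hr0 hr_cont hr hε hr' ht (y + r t)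
  have lower := hX.measureReal_Iic_le_add hV ha hρ hD hr0 hr_cont hr hε hr' ht (y - r t)
  have hr_nonneg := hr0 t ht
  have shift_upper := hlip (y + r t) y
  have shift_lower := hlip y (y - r t)
  rw [add_sub_cancel_right] at upper
  rw [sub_add_cancel] at lower
  rw [add_sub_cancel_left, abs_of_nonneg hr_nonneg] at shift_upper
  rw [sub_sub_cancel, abs_of_nonneg hr_nonneg] at shift_lower
  rw [abs_le] at *
  constructor <;> linarith

end Barrier

lemma cdfDistLE_half {E : ℝ} (hE : 0 < E)
    (hD : ∀ s ∈ Icc 0 T, CdfDistLE (E * Real.exp (4 * c * (a * κ) * s)) (ρ₀.map (X s)) (ρ s)) :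
    ∀ s ∈ Icc 0 T, CdfDistLE (E / 2 * Real.exp (4 * c * (a * κ) * s)) (ρ₀.map (X s)) (ρ s) := by
  intro t ht
  have := (hX.isMonoBiLipschitz 0).isProbabilityMeasure_map ρ₀
  have hM : (0 : ℝ) < a * κ := mod_cast ((hX.isMonoBiLipschitz 0).densityLE_map ha).pos
  set M : ℝ := a * κ
  set r : ℝ → ℝ := fun s => E / (2 * M) * Real.exp (4 * c * M * s) with hr_def
  have hr : ∀ s, HasDerivAt r (4 * c * M * r s) s := fun s =>
    ((((hasDerivAt_id s).const_mul (4 * c * M)).exp).const_mul (E / (2 * M))).congr_deriv (by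
      simp [hr_def]; ring)
  have hMr : ∀ s, M * r s = E / 2 * Real.exp (4 * c * M * s) := fun s => by
    simp only [hr_def]; field_simp
  rw [← hMr]
  refine hX.cdfDistLE_mul hV ha hρ hD (ε := E / (2 * M)) (fun s _ => by positivity)
    (fun s _ => (hr s).continuousAt.continuousWithinAt) (fun s _ => hr s) (by positivity)
    (fun s hs => ?_) ht
  have hε : E / (2 * M) ≤ r s :=
    le_mul_of_one_le_right (by positivity) (Real.one_le_exp (by have := hs.1; positivity))
  calc c * (M * (r s + E / (2 * M)) + E * Real.exp (4 * c * M * s))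
      ≤ c * (M * (r s + r s) + E * Real.exp (4 * c * M * s)) := by gcongr
    _ = 4 * c * M * r s := by linear_combination (-2 * c : ℝ) * hMr s

theorem eq_map (ht : t ∈ Icc 0 T) : ρ t = ρ₀.map (X t) := by
  have := (hX.isMonoBiLipschitz t).isProbabilityMeasure_map ρ₀
  have := (hρ.curve.mem t ht).prob
  have halved : ∀ n : ℕ, ∀ s ∈ Icc 0 T, CdfDistLE ((1 / 2) ^ n * Real.exp (4 * c * (a * κ) * s))
      (ρ₀.map (X s)) (ρ s) := fun n => by
    induction n with
    | zero =>
      intro s hs y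
      have := (hX.isMonoBiLipschitz s).isProbabilityMeasure_map ρ₀
      have := (hρ.curve.mem s hs).prob
      rw [pow_zero, one_mul]
      exact (abs_sub_le_of_nonneg_of_le measureReal_nonneg measureReal_le_one measureReal_nonneg
        measureReal_le_one).trans (Real.one_le_exp (by have := hs.1; positivity))
    | succ n ih =>
      rw [pow_succ, mul_one_div]
      exact hX.cdfDistLE_half hV ha hρ (by positivity) ih
  have hlim : Tendsto (fun n : ℕ => (1 / 2) ^ n * Real.exp (4 * c * (a * κ) * t)) atTop (𝓝 0) := by
    simpa using (tendsto_pow_atTop_nhds_zero_of_lt_one one_half_pos.le one_half_lt_one).mul_const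
      (Real.exp (4 * c * (a * κ) * t))
  refine Measure.ext_of_Iic _ _ fun y => (measureReal_eq_measureReal_iff).1 ?_
  exact (eq_of_abs_sub_nonpos (ge_of_tendsto' hlim fun n => halved n t ht y)).symm

end IsLagrangianSolution

/-! ### Well-posedness -/

lemma existsUnique_and_tendsto_euler {v w : ℝ → ℝ} {c C : ℝ≥0} {T : ℝ} {ρ₀ : Measure ℝ}
    (hV : IsNonlocalField (velocity v w) c C) (hρ₀ : IsBddDensity ρ₀) (hT : 0 < T)
    (hcT : c * (linfNorm ρ₀).toNNReal * T < 1) :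
    ExistsUniqueWeakSolution v w ρ₀ T ∧ ∃ r : ℕ → ℝ → Measure ℝ,
      (∀ n, IsEulerTrajectory v w ρ₀ T n (r n) ∧ IsContCurve T (r n)) ∧
      ∃ ρ : ℝ → Measure ℝ, IsWeakSolution v w ρ₀ T ρ ∧
        Tendsto (fun n => ⨆ t ∈ Icc 0 T, Winf (r n t) (ρ t)) atTop (𝓝 0) := by
  have := hρ₀.prob
  have ha := hρ₀.densityLE
  have hh : ∀ n : ℕ, 0 < T / 2 ^ n := fun n => by positivity
  have hh_lim : Tendsto (fun n : ℕ => T / 2 ^ n) atTop (𝓝 0) :=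
    tendsto_const_nhds.div_atTop (tendsto_pow_atTop_atTop_of_one_lt one_lt_two)
  have hflow := fun n => isApproxFlow_eulerMap hV ha hcT (hh n)
  obtain ⟨Y, B, hY⟩ := exists_limit_of_isApproxFlow hV ha (fun n => (hh n).le) hh_lim hflow
  have hB_lim : Tendsto (fun n : ℕ => B * (T / 2 ^ n)) atTop (𝓝 0) := by
    simpa using hh_lim.const_mul B
  have hX := isLagrangianSolution_of_tendsto hV ha hT.le hh_lim hB_lim hflow hY
  have hweak := hX.isWeakSolution hV hρ₀ hT.le
  refine ⟨⟨⟨_, hweak⟩, fun ρ ρ' hρ hρ' t ht =>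
    (hX.eq_map hV ha hρ ht).trans (hX.eq_map hV ha hρ' ht).symm⟩, _, fun n =>
      ⟨isEulerTrajectory_eulerMap hV ha hT hcT n,
        isContCurve_map hρ₀ (hflow n).isMonoBiLipschitz (hflow n).lipschitzOnWith⟩, _, hweak, ?_⟩
  refine tendsto_of_tendsto_of_tendsto_of_le_of_le tendsto_const_nhds
    (by simpa using ENNReal.tendsto_ofReal hB_lim) (fun _ => zero_le) fun n =>
      iSup₂_le fun t ht => ?_
  refine Winf_map_le ((hflow n).isMonoBiLipschitz t ht).measurable
    (hX.isMonoBiLipschitz t).measurable fun x => ?_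
  rw [projIcc_of_mem hT.le ht]
  exact hY n t ht x

end NonlocalTransport

theorem mainTheorem3_general (v w : ℝ → ℝ) (L : ℝ≥0) (ρ₀ : Measure ℝ)
    (hv : LipschitzOnWith L v (Ici 0))
    (hvb : ∃ C : ℝ, ∀ s ∈ Ici (0 : ℝ), |v s| ≤ C)
    (hw_bv : BoundedVariationOn w univ)
    (hw_nonneg : ∀ x, 0 ≤ w x)
    (hρ₀ : NonlocalTransport.IsBddDensity ρ₀) :
    (∃ T : ℝ, 0 < T ∧ ∀ t ∈ Ioo 0 T,
      NonlocalTransport.ExistsUniqueWeakSolution v w ρ₀ t) ∧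
    ∀ T : ℝ, 0 < T →
      T * (L * (eVariationOn w univ).toReal * (NonlocalTransport.linfNorm ρ₀).toReal) < 1 →
      NonlocalTransport.ExistsUniqueWeakSolution v w ρ₀ T ∧
      ∃ r : ℕ → ℝ → Measure ℝ,
        (∀ n, NonlocalTransport.IsEulerTrajectory v w ρ₀ T n (r n) ∧
          NonlocalTransport.IsContCurve T (r n)) ∧
        ∃ ρ : ℝ → Measure ℝ, NonlocalTransport.IsWeakSolution v w ρ₀ T ρ ∧
          Tendsto (fun n => ⨆ t ∈ Icc 0 T, NonlocalTransport.Winf (r n t) (ρ t)) atTop (𝓝 0) := by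
  obtain ⟨C, hC⟩ := hvb
  have hV := NonlocalTransport.isNonlocalField_velocity hv
    (fun s hs => (hC s hs).trans (Real.le_coe_toNNReal C)) hw_bv hw_nonneg
  set q : ℝ := L * (eVariationOn w univ).toReal * (NonlocalTransport.linfNorm ρ₀).toReal
  have wellPosed := fun T (hT : 0 < T) (hqT : T * q < 1) =>
    NonlocalTransport.existsUnique_and_tendsto_euler hV hρ₀ hT
      (by rwa [mul_comm, NNReal.coe_mul])
  refine ⟨⟨(q + 1)⁻¹, by positivity, fun t ht => (wellPosed t ht.1 ?_).1⟩, wellPosed⟩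
  calc t * q ≤ t * (q + 1) := by gcongr; exacts [ht.1.le, le_add_of_nonneg_right zero_le_one]
    _ < 1 := (lt_inv_mul_iff₀' (by positivity)).1 (by simpa using ht.2)

theorem mainTheorem3 (v w : ℝ → ℝ) (L : ℝ≥0) (α β : ℝ) (ρ₀ : Measure ℝ)
    (hv : LipschitzOnWith L v (Ici 0))
    (hvb : ∃ C : ℝ, ∀ s ∈ Ici (0 : ℝ), |v s| ≤ C)
    (hw_bv : BoundedVariationOn w (Icc α β))
    (hw_nonneg : ∀ x, 0 ≤ w x)
    (hw_zero : ∀ x, x ∉ Icc α β → w x = 0)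
    (hw_int : ∫ x in Icc α β, w x = 1)
    (hρ₀ : NonlocalTransport.IsBddDensity ρ₀) :
    (∃ T : ℝ, 0 < T ∧ ∀ t ∈ Ioo 0 T,
      NonlocalTransport.ExistsUniqueWeakSolution v w ρ₀ t) ∧
    ∀ T : ℝ, 0 < T →
      T * (Real.exp 1 * L * (eVariationOn w univ).toReal *
        (NonlocalTransport.linfNorm ρ₀).toReal) < 1 →
      NonlocalTransport.ExistsUniqueWeakSolution v w ρ₀ T ∧
      ∃ r : ℕ → ℝ → Measure ℝ,
        (∀ n, NonlocalTransport.IsEulerTrajectory v w ρ₀ T n (r n) ∧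
          NonlocalTransport.IsContCurve T (r n)) ∧
        ∃ (ρ : ℝ → Measure ℝ) (σ : ℕ → ℕ), StrictMono σ ∧
          NonlocalTransport.IsWeakSolution v w ρ₀ T ρ ∧
          Tendsto (fun n => ⨆ t ∈ Icc 0 T, NonlocalTransport.Winf (r (σ n) t) (ρ t))
            atTop (𝓝 0) := by
  refine (mainTheorem3_general v w L ρ₀ hv hvb
    (NonlocalTransport.boundedVariationOn_univ_of_support_subset_Icc hw_bv
      (Function.support_subset_iff'.2 hw_zero)) hw_nonneg hρ₀).imp_right fun h T hT hTc => ?_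
  obtain ⟨hunique, r, hr, ρ, hρ, hlim⟩ := h T hT (hTc.trans_le' (by
    gcongr; exact le_mul_of_one_le_left L.coe_nonneg (Real.one_le_exp zero_le_one)))
  exact ⟨hunique, r, hr, ρ, id, strictMono_id, hρ, hlim⟩
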